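/- Let $\mu$ be a probability measure on $[0,1]$. Let $\Lambda$ be a Poisson point process on $\mathbf R\times\mathbf Z$ whose intensity is Lebesgue measure times counting measure, and, given an enumeration of its points, attach to the points $(t,x)\in\Lambda$ marks $R(t,x)\in[0,1]$ which are independent of each other and of $\Lambda$ and all have distribution $\mu$. In the environment $(\Lambda,R)$ a particle moves on $\mathbf Z$ as follows: when at $x$, it stays there until the next time $t$ with $(t,x)\in\Lambda$, when it jumps to $x+1$ with probability $R(t,x)$ and to $x-1$ with probability $1-R(t,x)$, the jumps being independent given the environment. For $s\le t$ let $K^\mu_{s,t}(x,A)$ be the conditional probability, given the environment, that the particle started at $x$ at time $s$ is located in $A$ at time $t$. For $N\ge 0$ the $N$-point motion of the flow $K^\mu$ is described by the transition kernels $P^N_t$ $(t\ge 0)$ on $\mathbf Z^N$ given by $P^N_t(x,\cdot)=\mathbf E\big[K^\mu_{0,t}(x_1,\cdot)\otimes\cdots\otimes K^\mu_{0,t}(x_N,\cdot)\big]$. For $x\in\mathbf Z^N$ let $\pi(x)$ be the partition of $\{1,\dots,N\}$ in which $i,j$ lie in the same component if and only if $x_i=x_j$. For disjoint $I,J\subseteq\{1,\dots,N\}$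 let $v_{IJ}\in\mathbf Z^N$ have components $+1$ on $I$, $-1$ on $J$ and $0$ elsewhere, and let $\mathcal V(x)$ be the set of all $v_{IJ}$ such that $I\cap J=\emptyset$ and $I\cup J$ is a component of $\pi(x)$. For a family $p=(p(k:l);k,l\ge 0)$ put $$\mathcal G_N^pf(x)=\sum_{v\in\mathcal V(x)}p(v)\{f(x+v)-f(x)\},\qquad p(v_{IJ})=p(|I|:|J|).$$ Proposition 8.2. The $N$-point motion of $K^\mu$ is a continuous-time Markov chain on $\mathbf Z^N$ with generator $\mathcal G_N^p$, where $$p(k:l)=\int_{[0,1]} x^k(1-x)^l\,\mu(dx).$$ That is: $P^N_t(x,A_1\times\cdots\times A_N)=\mathbf E\big[\prod_{i=1}^NK^\mu_{0,t}(x_i,A_i)\big]$ for all $t\ge0$, $x\in\mathbf Z^N$ and $A_1,\dots,A_N\subseteq\mathbf Z$; the parameters $p(k:l)$ are nonnegative and satisfy $p(k:l)=p(k+1:l)+p(k:l+1)$ for all $k,l\ge0$; every $P^N_t$ is a Markov kernel, $P^N_0$ is the identity and $P^N_{s+t}=P^N_sP^N_t$; and for every bounded $f:\mathbf Z^N\to\mathbf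 R$, $(P^N_tf-f)/t\to\mathcal G_N^pf$ as $t\downarrow0$, uniformly on $\mathbf Z^N$. -/

import Mathlib

open MeasureTheory ProbabilityTheory Filter Topology
open scoped NNReal ENNReal

namespace LatticeFlow

/-! ### The environment -/

/-- A realization of the environment on `ℝ × ℤ`: an enumeration of the space-time points
together with the mark in `[0, 1]` attached to each of them. -/
structure Config where
  /-- the `n`-th space-time point `(t, x)` -/
  pt : ℕ → ℝ × ℤ
  /-- the mark attached to the `n`-th point -/
  mark : ℕ → unitInterval

/-- The set `Λ` of space-time points of a realization. -/
def Config.Λ (e : Config) : Set (ℝ × ℤ) := Set.range e.pt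

open Classical in
/-- The mark `R(t, x)` of a point `(t, x) ∈ Λ` (the value off `Λ` is irrelevant). -/
noncomputable def Config.R (e : Config) (q : ℝ × ℤ) : unitInterval :=
  if h : ∃ n, e.pt n = q then e.mark (Nat.find h) else 0

/-- The number of points of a realization in a set `B`. -/
noncomputable def Config.count (e : Config) (B : Set (ℝ × ℤ)) : ℕ∞ := {n | e.pt n ∈ B}.encard

/-- The random environment `(Λ, R)` with mark distribution `μ`: the points form a Poisson point
process on `ℝ × ℤ` whose intensity is Lebesgue measure times counting measure, and the marks are
i.i.d. with distribution `μ` and independent of the points. -/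
structure IsPoissonEnvironment {Ω : Type*} [MeasurableSpace Ω] (P : Measure Ω)
    (μ : Measure unitInterval) (env : Ω → Config) : Prop where
  measurable_pt : ∀ n, Measurable fun ω => (env ω).pt n
  measurable_mark : ∀ n, Measurable fun ω => (env ω).mark n
  /-- The number of points in a set of finite intensity is Poisson distributed. -/
  poisson : ∀ B : Set (ℝ × ℤ), MeasurableSet B →
    ((volume : Measure ℝ).prod (Measure.count : Measure ℤ)) B ≠ ∞ → ∀ k : ℕ,
      P {ω | (env ω).count B = k} =
        poissonMeasure (((volume : Measure ℝ).prod (Measure.count : Measure ℤ)) B).toNNReal {k}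
  /-- The numbers of points in finitely many disjoint sets are independent. -/
  indep_count : ∀ (m : ℕ) (B : Fin m → Set (ℝ × ℤ)), (∀ i, MeasurableSet (B i)) →
    (Pairwise fun i j => Disjoint (B i) (B j)) →
      iIndepFun (fun i ω => (env ω).count (B i)) P
  /-- Each mark has distribution `μ`. -/
  law_mark : ∀ n, HasLaw (fun ω => (env ω).mark n) μ P
  /-- The marks are independent of each other. -/
  indep_mark : iIndepFun (fun n ω => (env ω).mark n) P
  /-- The marks are independent of the points. -/
  indep_pt_mark : IndepFun (fun ω => (env ω).pt) (fun ω => (env ω).mark) P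

/-! ### The flow of kernels -/

/-- There is no point of the environment at site `x` during the time interval `(s, t]`. -/
def Config.Quiet (e : Config) (s t : ℝ) (x : ℤ) : Prop :=
  ∀ u, s < u → u ≤ t → (u, x) ∉ e.Λ

/-- The time of the first point of the environment at site `x` strictly after time `s`. -/
noncomputable def Config.next (e : Config) (s : ℝ) (x : ℤ) : ℝ :=
  sInf {u | s < u ∧ (u, x) ∈ e.Λ}

open Classical in
/-- In a fixed environment, the (sub-probability) law of the position at time `t` of a particle
located at `x` at time `s`, on the event that it jumps exactly `n` times during `(s, t]`. The
particle stays at `x` until the first point `(u, x) ∈ Λ` with `u > s`; at time `u` it jumps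
to `x + 1` with probability `R(u, x)` and to `x - 1` with probability `1 - R(u, x)`, and then it
continues from there in the same way, its jumps being independent given the environment. -/
noncomputable def Config.jumpLaw (e : Config) (t : ℝ) : ℕ → ℝ → ℤ → Measure ℤ
  | 0, s, x => if e.Quiet s t x then Measure.dirac x else 0
  | n + 1, s, x =>
      if e.Quiet s t x then 0
      else
        ENNReal.ofReal (e.R (e.next s x, x)) • Config.jumpLaw e t n (e.next s x) (x + 1) +
        ENNReal.ofReal (1 - e.R (e.next s x, x)) • Config.jumpLaw e t n (e.next s x) (x - 1)

/-- The flow of kernels: `e.K s t x A` is the probability, in the fixed environment `e`, that the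
particle located at `x` at time `s` is located in `A` at time `t`. -/
noncomputable def Config.K (e : Config) (s t : ℝ) (x : ℤ) : Measure ℤ :=
  Measure.sum fun n => e.jumpLaw t n s x

/-- The semigroup of the `N`-point motion of the flow, `P_t^N(x, ·) = E[⨂ᵢ K_{0,t}(xᵢ, ·)]`. -/
noncomputable def nPointSemigroup {Ω : Type*} [MeasurableSpace Ω] (P : Measure Ω)
    (env : Ω → Config) (N : ℕ) (t : ℝ≥0) : Kernel (Fin N → ℤ) (Fin N → ℤ) :=
  Kernel.ofFunOfCountable fun x =>
    P.bind fun ω => Measure.pi fun i => (env ω).K 0 t (x i)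

/-! ### Markov semigroups and generators -/

/-- `Q` is the transition semigroup of a (conservative, time-homogeneous) Markov process. -/
structure IsMarkovSemigroup {S : Type*} [MeasurableSpace S] (Q : ℝ≥0 → Kernel S S) : Prop where
  markov : ∀ t, IsMarkovKernel (Q t)
  zero : Q 0 = Kernel.id
  chapman_kolmogorov : ∀ s t, Q (s + t) = Q t ∘ₖ Q s

/-- `Q` is the transition semigroup of a continuous-time Markov chain with generator `G`, a
generator acting on all bounded functions: `(Q_t f - f) / t → G f` uniformly as `t ↓ 0`. -/
structure IsMarkovChainWithGenerator {S : Type*} [MeasurableSpace S]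
    (Q : ℝ≥0 → Kernel S S) (G : (S → ℝ) → (S → ℝ)) : Prop extends IsMarkovSemigroup Q where
  generator : ∀ f : S → ℝ, (∃ C, ∀ x, |f x| ≤ C) →
    TendstoUniformly (fun (t : ℝ≥0) x => ((∫ y, f y ∂(Q t x)) - f x) / t) (G f) (𝓝[>] 0)

/-! ### The generator of the chain -/

/-- The vector `v_{IJ}`: `1` on `I`, `-1` on `J`, and `0` elsewhere (for disjoint `I`, `J`). -/
def vec {N : ℕ} (I J : Finset (Fin N)) : Fin N → ℤ :=
  fun i => if i ∈ I then 1 else if i ∈ J then -1 else 0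

/-- The component containing `k` of the partition `π(x)`, in which `i` and `j` belong to the same
component if and only if `xᵢ = xⱼ`. -/
def component {N : ℕ} (x : Fin N → ℤ) (k : Fin N) : Finset (Fin N) :=
  {i | x i = x k}

/-- The pairs `(I, J)` of disjoint sets whose union is a component of `π(x)`; the vectors
`v_{IJ}`, which determine `(I, J)`, form the set `𝒱(x)`. -/
def splittings {N : ℕ} (x : Fin N → ℤ) : Finset (Finset (Fin N) × Finset (Fin N)) :=
  {IJ | Disjoint IJ.1 IJ.2 ∧ ∃ k, IJ.1 ∪ IJ.2 = component x k}

/-- The operator `𝒢_N^p f(x) = ∑_{v ∈ 𝒱(x)} p(v) (f(x + v) - f(x))`, where `p(v) = p(|I| : |J|)`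
for `v = v_{IJ}`. -/
def generator (N : ℕ) (p : ℕ → ℕ → ℝ) (f : (Fin N → ℤ) → ℝ) (x : Fin N → ℤ) : ℝ :=
  ∑ IJ ∈ splittings x, p IJ.1.card IJ.2.card * (f (x + vec IJ.1 IJ.2) - f x)

/-- `p` is a family of nonnegative parameters with `p(k:l) = p(k+1:l) + p(k:l+1)`. -/
def IsConsistentFamily (p : ℕ → ℕ → ℝ) : Prop :=
  (∀ k l, 0 ≤ p k l) ∧ ∀ k l, p k l = p (k + 1) l + p k (l + 1)

/-- The parameters `p(k:l) = ∫ x^k (1 - x)^l μ(dx)`. -/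
noncomputable def splitRate (μ : Measure unitInterval) (k l : ℕ) : ℝ :=
  ∫ r : unitInterval, (r : ℝ) ^ k * (1 - (r : ℝ)) ^ l ∂μ

end LatticeFlow

/-!
The transition operators of the `N`-point motion are the exponentials `exp (t 𝒢)` of the generator,
which is a bounded operator on bounded functions. The Markov property and the uniform derivative at
`t = 0` are then properties of the exponential series.

The exponential is reached by discretizing time. Cut `(0, t]` into slabs of length `h`, and in each
cell (slab) × (site) replace the environment by the increment law of the mark of its point if it has
exactly one point, and by "stay put" otherwise. Two facts about the resulting product of random
one-step kernels carry the proof.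

* It is eventually exact. Almost surely there are sites to the left and to the right of all
  particles that have no point during `(0, t]` (`ae_exists_quiet`), so that the particles are
  confined to a finite window, and in a finite window every slab of a fine discretization has at
  most one point (`ae_eventually_count_slab_le_one`). In that case the discretized flow coincides
  with `K` (`Config.integral_pi_K_eq_pathOp`). This also shows that there is no explosion and that
  the flow is almost everywhere measurable in the environment.
* Its average is the power of a single operator. Given the points, the marks of points in disjoint
  cells belong to different indices of the enumeration, and the counts of disjoint cells are
  independent, so the increment laws of the cells are i.i.d. (`iIndepFun_weight`, `map_weight`), and
  the average of the product is the power of the average (`integral_pathOp`).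

The averaged step is `1 + h 𝒢 + O(h ^ 2)` in operator norm (`norm_meanOp_sub_le`): a site carries a
mark with probability `h * exp (-h)`, its particles then split as in `𝒢`, and two occupied sites
both carry marks only with probability `O(h ^ 2)`. Hence its powers converge to `exp (t 𝒢)`
(`tendsto_pow_exp_smul`).
-/

namespace LatticeFlow

/-! ### Quenched flow in a fixed environment -/

namespace Config

variable (e : Config)

lemma jumpLaw_eq_of_quiet {s s' t : ℝ} {x : ℤ} (hs : s ≤ s')
    (hq : e.Quiet s s' x) (n : ℕ) : e.jumpLaw t n s x = e.jumpLaw t n s' x := by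
  have hQ : e.Quiet s t x ↔ e.Quiet s' t x :=
    ⟨fun h u hu hut => h u (hs.trans_lt hu) hut, fun h u hu hut => by
      by_cases hus : u ≤ s'
      · exact hq u hu hus
      · exact h u (not_le.1 hus) hut⟩
  have hN : e.next s x = e.next s' x := by
    unfold next
    congr 1
    ext u
    refine ⟨fun h => ⟨?_, h.2⟩, fun h => ⟨hs.trans_lt h.1, h.2⟩⟩
    by_contra hus
    exact hq u h.1 (not_lt.1 hus) h.2
  by_cases h : e.Quiet s t x
  · cases n <;> simp [jumpLaw, h, hQ.1 h]
  · cases n <;> simp [jumpLaw, h, mt hQ.2 h, hN]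

lemma K_eq_of_quiet {s s' t : ℝ} {x : ℤ} (hs : s ≤ s') (hq : e.Quiet s s' x) :
    e.K s t x = e.K s' t x := by
  simp only [K, e.jumpLaw_eq_of_quiet hs hq]

lemma K_self (t : ℝ) (x : ℤ) : e.K t t x = Measure.dirac x := by
  have hq : e.Quiet t t x := fun u h h' => absurd h (not_lt.2 h')
  ext A hA
  rw [K, Measure.sum_apply _ hA, tsum_eq_single 0]
  · simp [jumpLaw, hq]
  · rintro (_ | n) hn
    · exact absurd rfl hn
    · simp [jumpLaw, hq]

lemma K_of_not_quiet {s t : ℝ} {x : ℤ} (hq : ¬ e.Quiet s t x) :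
    e.K s t x = ENNReal.ofReal (e.R (e.next s x, x)) • e.K (e.next s x) t (x + 1) +
      ENNReal.ofReal (1 - e.R (e.next s x, x)) • e.K (e.next s x) t (x - 1) := by
  ext A hA
  rw [K, Measure.sum_apply _ hA, tsum_eq_zero_add' ENNReal.summable]
  simp [jumpLaw, hq, K, Measure.sum_apply _ hA, ENNReal.tsum_add, ENNReal.tsum_mul_left]

lemma sum_jumpLaw_univ_le_one (t : ℝ) (n : ℕ) (s : ℝ) (x : ℤ) :
    ∑ k ∈ Finset.range n, e.jumpLaw t k s x Set.univ ≤ 1 := by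
  induction n generalizing s x with
  | zero => simp
  | succ n ih =>
    rw [Finset.sum_range_succ']
    by_cases hq : e.Quiet s t x
    · simp [jumpLaw, hq]
    · simp only [jumpLaw, hq, if_false, Measure.coe_add, Measure.coe_smul, Pi.add_apply,
        Pi.smul_apply, smul_eq_mul, Finset.sum_add_distrib, ← Finset.mul_sum]
      set r := e.R (e.next s x, x)
      calc _ ≤ ENNReal.ofReal r * 1 + ENNReal.ofReal (1 - r) * 1 + 0 := by
            gcongr
            · exact ih _ _
            · exact ih _ _
            · simp
        _ = 1 := by
          rw [mul_one, mul_one, add_zero, ← ENNReal.ofReal_add r.2.1 (sub_nonneg.2 r.2.2)]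
          simp

/-- `K` is sub-Markov in every environment; it is Markov only almost surely. -/
instance isFiniteMeasure_K (s t : ℝ) (x : ℤ) : IsFiniteMeasure (e.K s t x) := by
  refine ⟨lt_of_le_of_lt ?_ ENNReal.one_lt_top⟩
  rw [K, Measure.sum_apply _ MeasurableSet.univ]
  exact ENNReal.tsum_le_of_sum_range_le fun n => e.sum_jumpLaw_univ_le_one t n s x

end Config

/-! ### One-step weights and the discretized flow -/

/-- The increment of a particle that does not move, as a vector of weights on `{-1, 0, 1}`. -/
def stay : SignType → ℝ := Pi.single 0 1

/-- The law on `{-1, 0, 1}` of the increment of a particle at a point with mark `r`. -/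
def jump (r : unitInterval) : SignType → ℝ
  | 1 => r
  | -1 => 1 - r
  | 0 => 0

lemma sum_signType {M : Type*} [AddCommMonoid M] (g : SignType → M) :
    ∑ v, g v = g 0 + g (-1) + g 1 := by
  have : (Finset.univ : Finset SignType) = {0, -1, 1} := by decide
  rw [this, Finset.sum_insert (by decide), Finset.sum_insert (by decide), Finset.sum_singleton,
    add_assoc]

/-- Probability weights on the increments `{-1, 0, 1}`. -/
def IsWeight (w : SignType → ℝ) : Prop := (∀ v, 0 ≤ w v) ∧ ∑ v, w v = 1

lemma isWeight_stay : IsWeight stay := by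
  refine ⟨fun v => ?_, by simp [stay]⟩
  unfold stay
  rw [Pi.single_apply]
  positivity

lemma isWeight_jump (r : unitInterval) : IsWeight (jump r) := by
  refine ⟨fun v => ?_, ?_⟩
  · cases v
    · exact le_rfl
    · exact sub_nonneg.2 r.2.2
    · exact r.2.1
  · rw [sum_signType]
    change (0 : ℝ) + (1 - r) + r = 1
    ring

open Classical in
/-- The increment weights that the environment induces in a space-time cell `B`: those of the mark
of the unique point in `B`, or staying put if `B` does not contain exactly one point. -/
noncomputable def Config.weight (e : Config) (B : Set (ℝ × ℤ)) : SignType → ℝ :=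
  if e.count B = 1 then jump (e.mark (sInf {n | e.pt n ∈ B})) else stay

lemma Config.isWeight_weight (e : Config) (B : Set (ℝ × ℤ)) : IsWeight (e.weight B) := by
  unfold weight
  split_ifs
  · exact isWeight_jump _
  · exact isWeight_stay

/-- One step of `N` particles, each moving independently with the increment weights `z` of the
site where it is, acting on functions. -/
def stepOp {N : ℕ} (z : ℤ → SignType → ℝ) (f : (Fin N → ℤ) → ℝ) (x : Fin N → ℤ) : ℝ :=
  ∑ v : Fin N → SignType, (∏ i, z (x i) (v i)) * f (x + fun i => (v i : ℤ))

/-- The composition of `n` steps with the successive weights `z 0, …, z (n - 1)`. -/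
def pathOp {N : ℕ} (z : ℕ → ℤ → SignType → ℝ) : ℕ → ((Fin N → ℤ) → ℝ) → (Fin N → ℤ) → ℝ
  | 0, f => f
  | n + 1, f => stepOp (z 0) (pathOp (fun j => z (j + 1)) n f)

lemma sum_prod_eq_one {N : ℕ} {w : Fin N → SignType → ℝ} (hw : ∀ i, IsWeight (w i)) :
    ∑ v : Fin N → SignType, ∏ i, w i (v i) = 1 := by
  rw [← Fintype.piFinset_univ, ← Finset.prod_univ_sum]
  exact Finset.prod_eq_one fun i _ => (hw i).2

lemma abs_stepOp_le {N : ℕ} {z : ℤ → SignType → ℝ} (hz : ∀ y, IsWeight (z y))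
    {f : (Fin N → ℤ) → ℝ} {C : ℝ} (hf : ∀ x, |f x| ≤ C) (x : Fin N → ℤ) : |stepOp z f x| ≤ C := by
  have h0 : ∀ v : Fin N → SignType, 0 ≤ ∏ i, z (x i) (v i) := fun v =>
    Finset.prod_nonneg fun i _ => (hz _).1 _
  calc |stepOp z f x| ≤ ∑ v : Fin N → SignType, (∏ i, z (x i) (v i)) * C := by
        refine (Finset.abs_sum_le_sum_abs _ _).trans (Finset.sum_le_sum fun v _ => ?_)
        rw [abs_mul, abs_of_nonneg (h0 v)]
        exact mul_le_mul_of_nonneg_left (hf _) (h0 v)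
    _ = C := by rw [← Finset.sum_mul, sum_prod_eq_one fun i => hz (x i), one_mul]

lemma abs_pathOp_le {N : ℕ} {z : ℕ → ℤ → SignType → ℝ} (hz : ∀ j y, IsWeight (z j y)) (n : ℕ)
    {f : (Fin N → ℤ) → ℝ} {C : ℝ} (hf : ∀ x, |f x| ≤ C) (x : Fin N → ℤ) :
    |pathOp z n f x| ≤ C := by
  induction n generalizing z x with
  | zero => exact hf x
  | succ n ih => exact abs_stepOp_le (hz 0) (fun y => ih (fun j => hz (j + 1)) y) x

/-! ### Exactness of the discretization -/

lemma Config.count_eq_zero_iff (e : Config) (B : Set (ℝ × ℤ)) :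
    e.count B = 0 ↔ ∀ n, e.pt n ∉ B := by
  simp [count, Set.encard_eq_zero, Set.eq_empty_iff_forall_notMem]

lemma Config.count_eq_one_iff (e : Config) (B : Set (ℝ × ℤ)) :
    e.count B = 1 ↔ ∃ n, e.pt n ∈ B ∧ ∀ m, e.pt m ∈ B → m = n := by
  rw [count, Set.encard_eq_one]
  refine exists_congr fun n => ⟨fun h => ?_, fun h => ?_⟩
  · exact ⟨h.symm.subset (Set.mem_singleton n), fun m hm => by
      have : m ∈ {n | e.pt n ∈ B} := hm
      rwa [h] at this⟩
  · ext m
    exact ⟨fun hm => h.2 m hm, fun hm => by rw [Set.mem_singleton_iff.1 hm]; exact h.1⟩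

lemma Config.count_le_one_iff (e : Config) (B : Set (ℝ × ℤ)) :
    e.count B ≤ 1 ↔ ∀ m n, e.pt m ∈ B → e.pt n ∈ B → m = n := by
  rw [count, Set.encard_le_one_iff]
  rfl

lemma Config.quiet_iff_count (e : Config) (s t : ℝ) (x : ℤ) :
    e.Quiet s t x ↔ e.count (Set.Ioc s t ×ˢ {x}) = 0 := by
  rw [count_eq_zero_iff]
  constructor
  · rintro h n ⟨⟨h1, h2⟩, h3⟩
    refine h _ h1 h2 ⟨n, ?_⟩
    rw [← Set.mem_singleton_iff.1 h3]
  · rintro h u h1 h2 ⟨n, hn⟩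
    exact h n (by rw [hn]; exact ⟨⟨h1, h2⟩, rfl⟩)

lemma Config.weight_of_quiet (e : Config) {s t : ℝ} {x : ℤ} (hq : e.Quiet s t x) :
    e.weight (Set.Ioc s t ×ˢ {x}) = stay := by
  rw [weight, (e.quiet_iff_count s t x).1 hq, if_neg zero_ne_one]

/-- A time slab that contains at most one point between two quiet sites acts on a particle started
between them by a single step with the weights of its cell. -/
theorem Config.K_eq_sum_weight (e : Config) {s s' t : ℝ} (hs : s ≤ s') (ht : s' ≤ t) {a b : ℤ}
    (ha : e.Quiet s s' a) (hb : e.Quiet s s' b)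
    (hc : e.count (Set.Ioc s s' ×ˢ Set.Icc a b) ≤ 1) {x : ℤ} (hx : x ∈ Set.Icc a b) :
    e.K s t x =
      ∑ v, ENNReal.ofReal (e.weight (Set.Ioc s s' ×ˢ {x}) v) • e.K s' t (x + (v : ℤ)) := by
  by_cases hq : e.Quiet s s' x
  · rw [e.weight_of_quiet hq, e.K_eq_of_quiet hs hq, sum_signType]
    simp [stay]
  · have hax : a < x := lt_of_le_of_ne hx.1 (by rintro rfl; exact hq ha)
    have hxb : x < b := lt_of_le_of_ne hx.2 (by rintro rfl; exact hq hb)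
    rw [count_le_one_iff] at hc
    have hq' := hq
    simp only [Quiet, not_forall, not_not] at hq'
    obtain ⟨u, hsu, hus, n, hn⟩ := hq'
    have hnB : e.pt n ∈ Set.Ioc s s' ×ˢ Set.Icc a b := by rw [hn]; exact ⟨⟨hsu, hus⟩, hx⟩
    have huniq : ∀ m, e.pt m ∈ Set.Ioc s s' ×ˢ Set.Icc a b → m = n := fun m hm => hc m n hm hnB
    -- the infimum defining `next` is attained at the only point of the cell of `x`
    have hnext : e.next s x = u := by
      refine le_antisymm (csInf_le ⟨s, fun v hv => hv.1.le⟩ ⟨hsu, n, hn⟩)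
        (le_csInf ⟨u, hsu, n, hn⟩ ?_)
      rintro v ⟨hv, m, hm⟩
      by_contra hvu
      have : m = n := huniq m (by rw [hm]; exact ⟨⟨hv, (not_le.1 hvu).le.trans hus⟩, hx⟩)
      subst this
      rw [hm] at hn
      exact hvu (congrArg Prod.fst hn).ge
    have hR : e.R (u, x) = e.mark n := by
      have hex : ∃ n, e.pt n = (u, x) := ⟨n, hn⟩
      rw [R, dif_pos hex]
      congr 1
      exact huniq _ (by rw [Nat.find_spec hex]; exact ⟨⟨hsu, hus⟩, hx⟩)
    have hcell : ∀ m, e.pt m ∈ Set.Ioc s s' ×ˢ ({x} : Set ℤ) ↔ m = n := fun m =>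
      ⟨fun h => huniq m ⟨h.1, by rw [Set.mem_singleton_iff.1 h.2]; exact hx⟩, fun h => by
        rw [h, hn]; exact ⟨⟨hsu, hus⟩, rfl⟩⟩
    have hw : e.weight (Set.Ioc s s' ×ˢ {x}) = jump (e.mark n) := by
      rw [weight, if_pos ((e.count_eq_one_iff _).2 ⟨n, (hcell n).2 rfl, fun m => (hcell m).1⟩)]
      simp [hcell]
    -- after its jump the particle sits at a site without points in the slab
    have hother : ∀ y ∈ Set.Icc a b, y ≠ x → e.K u t y = e.K s' t y := by
      intro y hy hyx
      refine e.K_eq_of_quiet hus ?_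
      rintro v hv hvs ⟨m, hm⟩
      have : m = n := huniq m (by rw [hm]; exact ⟨⟨hsu.trans hv, hvs⟩, hy⟩)
      subst this
      rw [hm] at hn
      exact hyx (congrArg Prod.snd hn)
    have hqt : ¬ e.Quiet s t x := fun h => h u hsu (hus.trans ht) ⟨n, hn⟩
    rw [e.K_of_not_quiet hqt, hnext, hR, hw, hother (x + 1) ⟨by lia, by lia⟩ (by lia),
      hother (x - 1) ⟨by lia, by lia⟩ (by lia), sum_signType]
    have h1 : jump (e.mark n) 1 = e.mark n := rfl
    have h2 : jump (e.mark n) (-1) = 1 - e.mark n := rfl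
    have h3 : jump (e.mark n) 0 = 0 := rfl
    rw [h1, h2, h3]
    simp [add_comm, sub_eq_add_neg]

/-- Particles cannot leave an interval with quiet endpoints. -/
lemma Config.mem_Icc_of_weight_ne_zero (e : Config) {s s' : ℝ} {a b : ℤ}
    (ha : e.Quiet s s' a) (hb : e.Quiet s s' b) {x : ℤ} (hx : x ∈ Set.Icc a b) {v : SignType}
    (hv : e.weight (Set.Ioc s s' ×ˢ {x}) v ≠ 0) : x + (v : ℤ) ∈ Set.Icc a b := by
  by_cases hq : e.Quiet s s' x
  · rw [e.weight_of_quiet hq] at hv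
    have : v = 0 := by
      by_contra h
      exact hv (Pi.single_eq_of_ne h 1)
    subst this
    simpa using hx
  · have hax : a < x := lt_of_le_of_ne hx.1 (by rintro rfl; exact hq ha)
    have hxb : x < b := lt_of_le_of_ne hx.2 (by rintro rfl; exact hq hb)
    have hv1 : -1 ≤ (v : ℤ) ∧ (v : ℤ) ≤ 1 := by cases v <;> decide
    exact ⟨by lia, by lia⟩

/-- The product measure is multilinear in its factors. -/
lemma pi_sum_smul {N : ℕ} (c : Fin N → SignType → ℝ) (m : Fin N → SignType → Measure ℤ)
    [∀ i v, IsFiniteMeasure (m i v)] :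
    Measure.pi (fun i => ∑ v, ENNReal.ofReal (c i v) • m i v) =
      ∑ v : Fin N → SignType,
        (∏ i, ENNReal.ofReal (c i (v i))) • Measure.pi (fun i => m i (v i)) := by
  have hfin : ∀ i, IsFiniteMeasure (∑ v, ENNReal.ofReal (c i v) • m i v) := fun i => by
    refine ⟨?_⟩
    rw [Measure.finsetSum_apply]
    exact ENNReal.sum_lt_top.2 fun v _ => ENNReal.mul_lt_top ENNReal.ofReal_lt_top
      (measure_lt_top _ _)
  refine Measure.ext_of_singleton fun y => ?_
  rw [Measure.pi_singleton, Measure.finsetSum_apply]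
  simp_rw [Measure.finsetSum_apply, Measure.smul_apply, Measure.pi_singleton, smul_eq_mul,
    ← Finset.prod_mul_distrib]
  rw [Finset.prod_univ_sum, Fintype.piFinset_univ]

/-- The weights of the cells `(s + j h, s + (j + 1) h] × {y}` of a time discretization. -/
noncomputable def Config.cellWeight (e : Config) (h s : ℝ) (j : ℕ) (y : ℤ) : SignType → ℝ :=
  e.weight (Set.Ioc (s + j * h) (s + (j + 1) * h) ×ˢ {y})

lemma Config.isWeight_cellWeight (e : Config) (h s : ℝ) (j : ℕ) (y : ℤ) :
    IsWeight (e.cellWeight h s j y) := e.isWeight_weight _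

/-- If every slab of a time discretization of `(s, s + n h]` contains at most one point between two
sites that are quiet, then the discretized flow agrees with the flow for particles started between
these sites. -/
theorem Config.integral_pi_K_eq_pathOp (e : Config) {N : ℕ} {h : ℝ} (hh : 0 ≤ h) {a b : ℤ}
    (n : ℕ) (s : ℝ) (ha : e.Quiet s (s + n * h) a) (hb : e.Quiet s (s + n * h) b)
    (hc : ∀ j < n, e.count (Set.Ioc (s + j * h) (s + (j + 1) * h) ×ˢ Set.Icc a b) ≤ 1)
    {f : (Fin N → ℤ) → ℝ} {C : ℝ} (hf : ∀ x, |f x| ≤ C)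
    (x : Fin N → ℤ) (hx : ∀ i, x i ∈ Set.Icc a b) :
    ∫ y, f y ∂(Measure.pi fun i => e.K s (s + n * h) (x i)) = pathOp (e.cellWeight h s) n f x := by
  induction n generalizing s x with
  | zero =>
    simp only [Nat.cast_zero, zero_mul, add_zero, K_self, pathOp]
    have : Measure.pi (fun i => Measure.dirac (x i)) = Measure.dirac x := by
      refine Measure.ext_of_singleton fun y => ?_
      rw [Measure.pi_singleton]
      simp only [MeasurableSet.singleton, Measure.dirac_apply', Set.indicator_apply,
        Set.mem_singleton_iff, Pi.one_apply]
      rw [Finset.prod_ite_zero]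
      simp [funext_iff]
    rw [this, integral_dirac]
  | succ n ih =>
    have hT : s + ((n + 1 : ℕ) : ℝ) * h = (s + h) + n * h := by push_cast; ring
    have hnh : 0 ≤ n * h := by positivity
    have ha0 : e.Quiet s (s + h) a := fun u hu hu' => ha u hu (by rw [hT]; linarith)
    have hb0 : e.Quiet s (s + h) b := fun u hu hu' => hb u hu (by rw [hT]; linarith)
    have hc0 : e.count (Set.Ioc s (s + h) ×ˢ Set.Icc a b) ≤ 1 := by
      simpa using hc 0 n.succ_pos
    have hcell0 : ∀ y, e.cellWeight h s 0 y = e.weight (Set.Ioc s (s + h) ×ˢ {y}) := fun y => by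
      simp [cellWeight]
    have hcellS : (fun j => e.cellWeight h s (j + 1)) = e.cellWeight h (s + h) := by
      funext j y
      unfold cellWeight
      congr 3 <;> push_cast <;> ring
    rw [pathOp, hcellS, stepOp, hT]
    have hK : (fun i => e.K s (s + h + n * h) (x i)) = fun i => ∑ v,
        ENNReal.ofReal (e.cellWeight h s 0 (x i) v) • e.K (s + h) (s + h + n * h) (x i + (v : ℤ)) :=
      funext fun i => by
        rw [hcell0, e.K_eq_sum_weight (by linarith) (by linarith) ha0 hb0 hc0 (hx i)]
    have hint : ∀ m : Measure (Fin N → ℤ), IsFiniteMeasure m → Integrable f m := fun m _ =>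
      Integrable.of_bound Measurable.of_discrete.aestronglyMeasurable C
        (Eventually.of_forall fun y => by simpa using hf y)
    rw [hK, pi_sum_smul, integral_finsetSum_measure fun v _ =>
      (hint _ inferInstance).smul_measure (ENNReal.prod_ne_top fun _ _ => ENNReal.ofReal_ne_top)]
    refine Finset.sum_congr rfl fun v _ => ?_
    have htoReal : ∀ i, (ENNReal.ofReal (e.cellWeight h s 0 (x i) (v i))).toReal =
        e.cellWeight h s 0 (x i) (v i) := fun i =>
      ENNReal.toReal_ofReal ((e.isWeight_cellWeight h s 0 _).1 _)
    rw [integral_smul_measure, ENNReal.toReal_prod, smul_eq_mul,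
      Finset.prod_congr rfl fun i _ => htoReal i]
    by_cases hv : ∏ i, e.cellWeight h s 0 (x i) (v i) = 0
    · rw [hv, zero_mul, zero_mul]
    · congr 1
      refine ih (s + h) (fun u hu hu' => ha u (by linarith) (by rw [hT]; exact hu'))
        (fun u hu hu' => hb u (by linarith) (by rw [hT]; exact hu')) (fun j hj => ?_) _ fun i => ?_
      · have := hc (j + 1) (by lia)
        convert this using 4 <;> push_cast <;> ring
      · refine e.mem_Icc_of_weight_ne_zero ha0 hb0 (hx i) ?_
        rw [← hcell0]
        exact fun h0 => hv (Finset.prod_eq_zero (Finset.mem_univ i) h0)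

/-! ### Independence of the cells of the environment -/

lemma measurable_jump : Measurable jump := by
  refine measurable_pi_iff.2 fun v => ?_
  cases v
  · exact measurable_const
  · exact measurable_const.sub measurable_subtype_coe
  · exact measurable_subtype_coe

lemma measurableSet_count_eq_one {B : Set (ℝ × ℤ)} (hB : MeasurableSet B) (m : ℕ → unitInterval) :
    MeasurableSet {p : ℕ → ℝ × ℤ | (Config.mk p m).count B = 1} := by
  simp only [Config.count_eq_one_iff]
  have h : ∀ n, MeasurableSet {p : ℕ → ℝ × ℤ | p n ∈ B} := fun n => measurable_pi_apply n hB
  refine measurableSet_setOfPred.2 (Measurable.exists fun n => (measurableSet_setOfPred.1 (h n)).and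
    (Measurable.forall fun k => (measurableSet_setOfPred.1 (h k)).imp measurable_const))

lemma measurable_weight {B : Set (ℝ × ℤ)} (hB : MeasurableSet B) :
    Measurable fun q : (ℕ → ℝ × ℤ) × (ℕ → unitInterval) => (Config.mk q.1 q.2).weight B := by
  intro A hA
  have hone : MeasurableSet {q : (ℕ → ℝ × ℤ) × (ℕ → unitInterval) |
      (Config.mk q.1 q.2).count B = 1} :=
    measurable_fst (measurableSet_count_eq_one hB fun _ => 0)
  have heq : (fun q : (ℕ → ℝ × ℤ) × (ℕ → unitInterval) => (Config.mk q.1 q.2).weight B) ⁻¹' A =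
      ({q | (Config.mk q.1 q.2).count B = 1}ᶜ ∩ {_q | stay ∈ A}) ∪
        ⋃ n, {q | (Config.mk q.1 q.2).count B = 1} ∩
          ({q | q.1 n ∈ B} ∩ {q | jump (q.2 n) ∈ A}) := by
    ext q
    simp only [Set.mem_preimage, Set.mem_union, Set.mem_inter_iff, Set.mem_compl_iff,
      Set.mem_ofPred_eq, Set.mem_iUnion, Config.weight]
    by_cases hq : (Config.mk q.1 q.2).count B = 1
    · obtain ⟨n, hn, huniq⟩ := ((Config.mk q.1 q.2).count_eq_one_iff B).1 hq
      have hset : {n | q.1 n ∈ B} = {n} :=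
        Set.eq_singleton_iff_unique_mem.2 ⟨hn, fun m hm => huniq m hm⟩
      simp only [hq, if_true, hset, csInf_singleton, not_true_eq_false, false_and, false_or,
        true_and]
      exact ⟨fun h => ⟨n, hn, h⟩, fun ⟨k, hk, h⟩ => by rwa [huniq k hk] at h⟩
    · simp [hq]
  rw [heq]
  refine (hone.compl.inter (MeasurableSet.const _)).union (MeasurableSet.iUnion fun n =>
    hone.inter (MeasurableSet.inter ?_ ?_))
  · exact ((measurable_pi_apply n).comp measurable_fst) hB
  · exact (measurable_jump.comp ((measurable_pi_apply n).comp measurable_snd)) hA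

section Environment

variable {Ω : Type*} [MeasurableSpace Ω] {P : Measure Ω} {μ : Measure unitInterval}
  {env : Ω → Config}

namespace IsPoissonEnvironment

lemma measurable_pts (henv : IsPoissonEnvironment P μ env) : Measurable fun ω => (env ω).pt :=
  measurable_pi_iff.2 henv.measurable_pt

lemma measurable_marks (henv : IsPoissonEnvironment P μ env) : Measurable fun ω => (env ω).mark :=
  measurable_pi_iff.2 henv.measurable_mark

lemma measurable_cell_weight (henv : IsPoissonEnvironment P μ env) {B : Set (ℝ × ℤ)}
    (hB : MeasurableSet B) : Measurable fun ω => (env ω).weight B :=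
  (measurable_weight hB).comp (henv.measurable_pts.prodMk henv.measurable_marks)

lemma measurableSet_count_one (henv : IsPoissonEnvironment P μ env) {B : Set (ℝ × ℤ)}
    (hB : MeasurableSet B) : MeasurableSet {ω | (env ω).count B = 1} :=
  henv.measurable_pts (measurableSet_count_eq_one hB fun _ => 0)

/-- Averaging over the marks only: given the points, the marks of the points that are alone in their
cell are i.i.d., since disjoint cells pick different indices of the enumeration. -/
lemma lintegral_prod_weight_mark (henv : IsPoissonEnvironment P μ env) {m : ℕ}
    {B : Fin m → Set (ℝ × ℤ)} (hdisj : Pairwise fun i j => Disjoint (B i) (B j))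
    {φ : Fin m → (SignType → ℝ) → ℝ≥0∞} (hφ : ∀ i, Measurable (φ i)) (e : Config) :
    ∫⁻ ω, ∏ i, φ i ((Config.mk e.pt (env ω).mark).weight (B i)) ∂P =
      ∏ i, if e.count (B i) = 1 then ∫⁻ r, φ i (jump r) ∂μ else φ i stay := by
  set S : Fin m → Prop := fun i => e.count (B i) = 1
  have hcount : ∀ (i) (m' : ℕ → unitInterval), (Config.mk e.pt m').count (B i) = e.count (B i) :=
    fun _ _ => rfl
  set idx : {i // S i} → ℕ := fun i => sInf {n | e.pt n ∈ B i}
  have hidx : ∀ i : {i // S i}, e.pt (idx i) ∈ B i := fun i => by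
    obtain ⟨n, hn, -⟩ := (e.count_eq_one_iff (B i)).1 i.2
    exact Nat.sInf_mem (s := {n | e.pt n ∈ B i}) ⟨n, hn⟩
  have hinj : Function.Injective idx := by
    intro i j hij
    by_contra hne
    have hd := hdisj (fun h => hne (Subtype.ext h) : (i : Fin m) ≠ j)
    exact Set.disjoint_left.1 hd (hidx i) (hij ▸ hidx j)
  have hmeas : ∀ i : {i // S i}, Measurable fun r => φ i (jump r) := fun i =>
    (hφ i).comp measurable_jump
  have hind : iIndepFun (fun (i : {i // S i}) ω => φ i (jump ((env ω).mark (idx i)))) P :=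
    (henv.indep_mark.precomp hinj).comp (fun i r => φ i (jump r)) hmeas
  classical
  calc ∫⁻ ω, ∏ i, φ i ((Config.mk e.pt (env ω).mark).weight (B i)) ∂P
      = ∫⁻ ω, (∏ i : {i // S i}, φ i (jump ((env ω).mark (idx i)))) *
          ∏ i : {i // ¬ S i}, φ i stay ∂P := by
        refine lintegral_congr fun ω => ?_
        rw [← Fintype.prod_subtype_mul_prod_subtype S]
        congr 1
        · refine Finset.prod_congr rfl fun i _ => ?_
          rw [Config.weight, hcount, if_pos i.2]
        · refine Finset.prod_congr rfl fun i _ => ?_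
          rw [Config.weight, hcount, if_neg i.2]
    _ = (∏ i : {i // S i}, ∫⁻ r, φ i (jump r) ∂μ) * ∏ i : {i // ¬ S i}, φ i stay := by
        have hmeas' : ∀ i : {i // S i}, Measurable fun ω => φ i (jump ((env ω).mark (idx i))) :=
          fun i => (hmeas i).comp (henv.measurable_mark _)
        rw [lintegral_mul_const _ (Finset.measurable_fun_prod _ fun i _ => hmeas' i),
          lintegral_prod_eq_prod_lintegral_of_indepFun _ _ hind hmeas']
        congr 1
        refine Finset.prod_congr rfl fun i _ => ?_
        rw [← (henv.law_mark (idx i)).map_eq, lintegral_map (hmeas i) (henv.measurable_mark _)]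
    _ = _ := by
        rw [← Fintype.prod_subtype_mul_prod_subtype S]
        congr 1
        · exact Finset.prod_congr rfl fun i _ => (if_pos i.2).symm
        · exact Finset.prod_congr rfl fun i _ => (if_neg i.2).symm

lemma intensity_cell (s t : ℝ) (S : Set ℤ) :
    ((volume : Measure ℝ).prod (Measure.count : Measure ℤ)) (Set.Ioc s t ×ˢ S) =
      ENNReal.ofReal (t - s) * S.encard := by
  rw [Measure.prod_prod, Real.volume_Ioc, Measure.count_apply (.of_discrete)]

lemma measure_count_eq (henv : IsPoissonEnvironment P μ env) {B : Set (ℝ × ℤ)}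
    (hB : MeasurableSet B) {h : ℝ} (hh : 0 ≤ h)
    (hBh : ((volume : Measure ℝ).prod (Measure.count : Measure ℤ)) B = ENNReal.ofReal h) (k : ℕ) :
    P {ω | (env ω).count B = k} =
      ENNReal.ofReal (Real.exp (-h) * h ^ k / k.factorial) := by
  rw [henv.poisson B hB (by simp [hBh]) k, poissonMeasure_singleton, hBh,
    ENNReal.coe_toNNReal_eq_toReal, ENNReal.toReal_ofReal hh]

variable [IsProbabilityMeasure P]

/-- Since points and marks are independent, the marks can be resampled from an independent copy
`ω'` of the randomness and averaged first; what remains depends on the counts only. -/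
lemma lintegral_prod_weight_eq_count (henv : IsPoissonEnvironment P μ env) {m : ℕ}
    {B : Fin m → Set (ℝ × ℤ)} (hB : ∀ i, MeasurableSet (B i))
    (hdisj : Pairwise fun i j => Disjoint (B i) (B j))
    {φ : Fin m → (SignType → ℝ) → ℝ≥0∞} (hφ : ∀ i, Measurable (φ i)) :
    ∫⁻ ω, ∏ i, φ i ((env ω).weight (B i)) ∂P =
      ∏ i, ∫⁻ ω, (if (env ω).count (B i) = 1 then ∫⁻ r, φ i (jump r) ∂μ else φ i stay) ∂P := by
  classical
  set G : (ℕ → ℝ × ℤ) × (ℕ → unitInterval) → ℝ≥0∞ := fun q =>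
    ∏ i, φ i ((Config.mk q.1 q.2).weight (B i))
  have hG : Measurable G :=
    Finset.measurable_fun_prod _ fun i _ => (hφ i).comp (measurable_weight (hB i))
  have hmap := (indepFun_iff_map_prod_eq_prod_map_map henv.measurable_pts.aemeasurable
    henv.measurable_marks.aemeasurable).1 henv.indep_pt_mark
  have : IsProbabilityMeasure (P.map fun ω => (env ω).mark) :=
    Measure.isProbabilityMeasure_map henv.measurable_marks.aemeasurable
  calc ∫⁻ ω, ∏ i, φ i ((env ω).weight (B i)) ∂P
      = ∫⁻ ω, G ((env ω).pt, (env ω).mark) ∂P := rfl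
    _ = ∫⁻ ω, ∫⁻ ω', G ((env ω).pt, (env ω').mark) ∂P ∂P := by
        rw [← lintegral_map hG (henv.measurable_pts.prodMk henv.measurable_marks), hmap,
          lintegral_prod _ hG.aemeasurable, lintegral_map hG.lintegral_prod_right'
            henv.measurable_pts]
        refine lintegral_congr fun ω => ?_
        exact lintegral_map (hG.comp measurable_prodMk_left) henv.measurable_marks
    _ = ∫⁻ ω, ∏ i, (if (env ω).count (B i) = 1 then ∫⁻ r, φ i (jump r) ∂μ else φ i stay) ∂P :=
        lintegral_congr fun ω => henv.lintegral_prod_weight_mark hdisj hφ (env ω)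
    _ = _ := by
        refine lintegral_prod_eq_prod_lintegral_of_indepFun _ _
          ((henv.indep_count m B hB hdisj).comp
            (fun i k => if k = 1 then ∫⁻ r, φ i (jump r) ∂μ else φ i stay)
            fun _ => Measurable.of_discrete) fun i => ?_
        exact Measurable.ite (henv.measurableSet_count_one (hB i)) measurable_const measurable_const

lemma lintegral_weight_eq_count (henv : IsPoissonEnvironment P μ env)
    {B : Set (ℝ × ℤ)} (hB : MeasurableSet B) {φ : (SignType → ℝ) → ℝ≥0∞} (hφ : Measurable φ) :
    ∫⁻ ω, φ ((env ω).weight B) ∂P =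
      ∫⁻ ω, (if (env ω).count B = 1 then ∫⁻ r, φ (jump r) ∂μ else φ stay) ∂P := by
  simpa using henv.lintegral_prod_weight_eq_count (m := 1) (B := fun _ => B) (fun _ => hB)
    (fun i j h => absurd (Subsingleton.elim i j) h) (φ := fun _ => φ) (fun _ => hφ)

/-- The weights of disjoint cells are independent. -/
theorem iIndepFun_weight (henv : IsPoissonEnvironment P μ env) {ι : Type*}
    {B : ι → Set (ℝ × ℤ)} (hB : ∀ i, MeasurableSet (B i))
    (hdisj : Pairwise fun i j => Disjoint (B i) (B j)) :
    iIndepFun (fun i ω => (env ω).weight (B i)) P := by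
  rw [iIndepFun_iff_measure_inter_preimage_eq_mul]
  intro S A hA
  set σ := S.equivFin.symm
  have hA' : ∀ k, MeasurableSet (A (σ k)) := fun k => hA _ (σ k).2
  have hone : ∀ i ∈ S, P ((fun ω => (env ω).weight (B i)) ⁻¹' A i) =
      ∫⁻ ω, (A i).indicator 1 ((env ω).weight (B i)) ∂P := fun i hi => by
    rw [← lintegral_indicator_one (henv.measurable_cell_weight (hB i) (hA i hi))]
    rfl
  calc P (⋂ i ∈ S, (fun ω => (env ω).weight (B i)) ⁻¹' A i)
      = ∫⁻ ω, ∏ k, (A (σ k)).indicator 1 ((env ω).weight (B (σ k))) ∂P := by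
        rw [← lintegral_indicator_one (Finset.measurableSet_biInter S fun i hi =>
          henv.measurable_cell_weight (hB i) (hA i hi))]
        refine lintegral_congr fun ω => ?_
        rw [σ.prod_comp (fun i : S => (A i).indicator (1 : (SignType → ℝ) → ℝ≥0∞)
          ((env ω).weight (B i))), Finset.prod_coe_sort S
          (fun i => (A i).indicator (1 : (SignType → ℝ) → ℝ≥0∞) ((env ω).weight (B i)))]
        classical
        simp only [Set.indicator_apply, Pi.one_apply, Set.mem_iInter, Set.mem_preimage]
        rw [Finset.prod_ite_zero]
        simp
    _ = ∏ k, ∫⁻ ω, (A (σ k)).indicator 1 ((env ω).weight (B (σ k))) ∂P := by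
        have hφ : ∀ k, Measurable ((A (σ k)).indicator (1 : (SignType → ℝ) → ℝ≥0∞)) := fun k =>
          measurable_one.indicator (hA' k)
        rw [henv.lintegral_prod_weight_eq_count (fun k => hB (σ k)) (fun k l hkl => hdisj
          fun h => hkl (σ.injective (Subtype.ext h))) hφ]
        exact Finset.prod_congr rfl fun k _ =>
          (henv.lintegral_weight_eq_count (hB _) (hφ k)).symm
    _ = ∏ i ∈ S, P ((fun ω => (env ω).weight (B i)) ⁻¹' A i) := by
        rw [σ.prod_comp (fun i : S => ∫⁻ ω, (A i).indicator (1 : (SignType → ℝ) → ℝ≥0∞)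
          ((env ω).weight (B i)) ∂P), Finset.prod_coe_sort S (fun i => ∫⁻ ω,
          (A i).indicator (1 : (SignType → ℝ) → ℝ≥0∞) ((env ω).weight (B i)) ∂P)]
        exact Finset.prod_congr rfl fun i hi => (hone i hi).symm

/-- The law of the weights of a cell of intensity `h`. -/
theorem map_weight [IsProbabilityMeasure μ] (henv : IsPoissonEnvironment P μ env)
    {B : Set (ℝ × ℤ)} (hB : MeasurableSet B) {h : ℝ} (hh : 0 ≤ h)
    (hBh : ((volume : Measure ℝ).prod (Measure.count : Measure ℤ)) B = ENNReal.ofReal h) :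
    P.map (fun ω => (env ω).weight B) =
      ENNReal.ofReal (1 - h * Real.exp (-h)) • Measure.dirac stay +
        ENNReal.ofReal (h * Real.exp (-h)) • μ.map jump := by
  have hP1 : P {ω | (env ω).count B = 1} = ENNReal.ofReal (h * Real.exp (-h)) := by
    have := henv.measure_count_eq hB hh hBh 1
    simpa [mul_comm] using this
  have hP1' : P {ω | (env ω).count B = 1}ᶜ = ENNReal.ofReal (1 - h * Real.exp (-h)) := by
    rw [prob_compl_eq_one_sub (henv.measurableSet_count_one hB), hP1, ← ENNReal.ofReal_one,
      ENNReal.ofReal_sub _ (by positivity)]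
  refine Measure.ext fun A hA => ?_
  rw [Measure.map_apply (henv.measurable_cell_weight hB) hA,
    ← lintegral_indicator_one (henv.measurable_cell_weight hB hA)]
  have key := henv.lintegral_weight_eq_count hB
    (measurable_one.indicator hA : Measurable (A.indicator (1 : (SignType → ℝ) → ℝ≥0∞)))
  refine key.trans ?_
  have hr : ∫⁻ r, A.indicator (1 : (SignType → ℝ) → ℝ≥0∞) (jump r) ∂μ = μ.map jump A := by
    rw [Measure.map_apply measurable_jump hA, ← lintegral_indicator_one (measurable_jump hA)]
    rfl
  rw [hr]
  classical
  have hsplit : ∀ ω, (if (env ω).count B = 1 then μ.map jump A else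
      A.indicator (1 : (SignType → ℝ) → ℝ≥0∞) stay) =
      {ω | (env ω).count B = 1}.indicator (fun _ => μ.map jump A) ω +
        {ω | (env ω).count B = 1}ᶜ.indicator (fun _ => A.indicator 1 stay) ω := fun ω => by
    by_cases hω : (env ω).count B = 1 <;> simp [hω]
  simp_rw [hsplit]
  rw [lintegral_add_left (measurable_const.indicator (henv.measurableSet_count_one hB)),
    lintegral_indicator_const (henv.measurableSet_count_one hB),
    lintegral_indicator_const (henv.measurableSet_count_one hB).compl, hP1, hP1']
  simp [hA, mul_comm, add_comm]

end IsPoissonEnvironment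

end Environment

/-! ### Almost sure exactness of fine discretizations -/

section Environment

variable {Ω : Type*} [MeasurableSpace Ω] {P : Measure Ω} {μ : Measure unitInterval}
  {env : Ω → Config}

namespace IsPoissonEnvironment

lemma measurableSet_count_zero (henv : IsPoissonEnvironment P μ env) {B : Set (ℝ × ℤ)}
    (hB : MeasurableSet B) : MeasurableSet {ω | (env ω).count B = 0} := by
  simp only [Config.count_eq_zero_iff]
  exact measurableSet_setOfPred.2 (Measurable.forall fun n =>
    (measurableSet_setOfPred.1 (henv.measurable_pt n hB)).not)

lemma measurableSet_cell (s t : ℝ) (S : Set ℤ) : MeasurableSet (Set.Ioc s t ×ˢ S) :=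
  measurableSet_Ioc.prod .of_discrete

variable [IsProbabilityMeasure P]

lemma measure_one_lt_count_le (henv : IsPoissonEnvironment P μ env) {B : Set (ℝ × ℤ)}
    (hB : MeasurableSet B) {h : ℝ} (hh : 0 ≤ h)
    (hBh : ((volume : Measure ℝ).prod (Measure.count : Measure ℤ)) B = ENNReal.ofReal h) :
    P {ω | ¬ (env ω).count B ≤ 1} ≤ ENNReal.ofReal (h ^ 2) := by
  have hset : {ω | ¬ (env ω).count B ≤ 1} =
      ({ω | (env ω).count B = 0} ∪ {ω | (env ω).count B = 1})ᶜ := by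
    ext ω
    simp only [Set.mem_ofPred_eq, Set.mem_compl_iff, Set.mem_union]
    rw [not_iff_not]
    refine ⟨fun hle => ?_, fun h01 => h01.elim (fun h => h ▸ zero_le_one) fun h => h.le⟩
    exact (lt_or_eq_of_le hle).imp_left fun h => Order.lt_one_iff.1 h
  have h0 := henv.measure_count_eq hB hh hBh 0
  have h1 := henv.measure_count_eq hB hh hBh 1
  simp only [Nat.cast_zero, pow_zero, mul_one, Nat.factorial_zero, Nat.cast_one, div_one, pow_one,
    Nat.factorial_one] at h0 h1
  have hd : Disjoint {ω | (env ω).count B = 0} {ω | (env ω).count B = 1} := by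
    rw [Set.disjoint_left]
    intro ω h h'
    exact zero_ne_one ((h : (env ω).count B = 0).symm.trans h')
  have hm0 := henv.measurableSet_count_zero hB
  have hm1 := henv.measurableSet_count_one hB
  rw [hset, prob_compl_eq_one_sub (hm0.union hm1), measure_union hd hm1, h0, h1,
    ← ENNReal.ofReal_add (by positivity) (by positivity), ← ENNReal.ofReal_one,
    ← ENNReal.ofReal_sub _ (by positivity)]
  refine ENNReal.ofReal_le_ofReal ?_
  -- `1 - (1 + h) * exp (-h) ≤ 1 - (1 + h) * (1 - h) = h ^ 2`
  have := Real.add_one_le_exp (-h)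
  nlinarith

/-- A finite window almost surely contains at most one point in each slab of a sufficiently fine
dyadic time discretization. -/
lemma ae_eventually_count_slab_le_one (henv : IsPoissonEnvironment P μ env) {t : ℝ} (ht : 0 ≤ t)
    (a b : ℤ) :
    ∀ᵐ ω ∂P, ∀ᶠ k : ℕ in atTop, ∀ j : ℕ, j < 2 ^ k → (env ω).count
      (Set.Ioc (0 + j * (t / 2 ^ k)) (0 + (j + 1) * (t / 2 ^ k)) ×ˢ Set.Icc a b) ≤ 1 := by
  set W : ℝ := ((Finset.Icc a b).card : ℝ)
  set B : ℕ → ℕ → Set (ℝ × ℤ) := fun k j =>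
    Set.Ioc (0 + j * (t / 2 ^ k)) (0 + (j + 1) * (t / 2 ^ k)) ×ˢ Set.Icc a b
  set bad : ℕ → Set Ω := fun k => ⋃ j ∈ Finset.range (2 ^ k), {ω | ¬ (env ω).count (B k j) ≤ 1}
  have hint : ∀ k j, ((volume : Measure ℝ).prod (Measure.count : Measure ℤ)) (B k j) =
      ENNReal.ofReal (t / 2 ^ k * W) := fun k j => by
    rw [intensity_cell, ENNReal.ofReal_mul (by positivity), ENNReal.ofReal_natCast,
      ← Finset.coe_Icc, Set.encard_coe_eq_coe_finsetCard]
    congr 2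
    ring
  have hbad : ∀ k, P (bad k) ≤ ENNReal.ofReal ((t * W) ^ 2 * (1 / 2) ^ k) := fun k => by
    calc P (bad k) ≤ ∑ j ∈ Finset.range (2 ^ k), P {ω | ¬ (env ω).count (B k j) ≤ 1} :=
          measure_biUnion_finset_le _ _
      _ ≤ ∑ j ∈ Finset.range (2 ^ k), ENNReal.ofReal ((t / 2 ^ k * W) ^ 2) :=
          Finset.sum_le_sum fun j _ => henv.measure_one_lt_count_le (measurableSet_cell _ _ _)
            (by positivity) (hint k j)
      _ = ENNReal.ofReal ((t * W) ^ 2 * (1 / 2) ^ k) := by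
          rw [Finset.sum_const, Finset.card_range, nsmul_eq_mul, ← ENNReal.ofReal_natCast,
            ← ENNReal.ofReal_mul (by positivity)]
          congr 1
          push_cast
          rw [one_div, inv_pow]
          field_simp
  have hsum : ∑' k, P (bad k) ≠ ∞ := by
    refine ne_top_of_le_ne_top ?_ (ENNReal.tsum_le_tsum hbad)
    exact (summable_geometric_two.mul_left _).tsum_ofReal_ne_top
  filter_upwards [ae_eventually_notMem hsum] with ω hω
  filter_upwards [hω] with k hk j hj
  by_contra hcon
  exact hk (Set.mem_biUnion (Finset.mem_coe.2 (Finset.mem_range.2 hj)) hcon)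

/-- Among infinitely many sites, one is almost surely quiet during `(0, t]`. -/
lemma ae_exists_quiet (henv : IsPoissonEnvironment P μ env) {t : ℝ} (ht : 0 ≤ t)
    {σ : ℕ → ℤ} (hσ : Function.Injective σ) : ∀ᵐ ω ∂P, ∃ i, (env ω).Quiet 0 t (σ i) := by
  have hcell : ∀ i, ((volume : Measure ℝ).prod (Measure.count : Measure ℤ))
      (Set.Ioc 0 t ×ˢ {σ i}) = ENNReal.ofReal t := fun i => by
    rw [intensity_cell]
    simp
  have h0 : ∀ i, P {ω | (env ω).count (Set.Ioc 0 t ×ˢ {σ i}) = 0}ᶜ =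
      ENNReal.ofReal (1 - Real.exp (-t)) := fun i => by
    have := henv.measure_count_eq (measurableSet_cell 0 t {σ i}) ht (hcell i) 0
    simp only [Nat.cast_zero, pow_zero, mul_one, Nat.factorial_zero, Nat.cast_one, div_one] at this
    rw [prob_compl_eq_one_sub (henv.measurableSet_count_zero (measurableSet_cell _ _ _)), this,
      ← ENNReal.ofReal_one, ENNReal.ofReal_sub _ (by positivity)]
  have hle : ∀ m : ℕ, P {ω | ¬ ∃ i, (env ω).Quiet 0 t (σ i)} ≤
      ENNReal.ofReal (1 - Real.exp (-t)) ^ m := fun m => by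
    have hind := henv.indep_count m (fun i => Set.Ioc 0 t ×ˢ {σ i})
      (fun i => measurableSet_cell _ _ _) fun i j hij => by
        refine Set.disjoint_left.2 fun q hq hq' => hij (Fin.ext (hσ ?_))
        exact (Set.mem_singleton_iff.1 hq.2).symm.trans (Set.mem_singleton_iff.1 hq'.2)
    have := hind.measure_inter_preimage_eq_mul Finset.univ (sets := fun _ => {0}ᶜ)
      fun i _ => MeasurableSet.of_discrete
    calc _ ≤ P (⋂ i ∈ (Finset.univ : Finset (Fin m)),
          (fun ω => (env ω).count (Set.Ioc 0 t ×ˢ {σ i})) ⁻¹' {0}ᶜ) := by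
          refine measure_mono fun ω hω => Set.mem_iInter₂.2 fun i _ h => hω ⟨i, ?_⟩
          exact ((env ω).quiet_iff_count 0 t (σ i)).2 h
      _ = ∏ i : Fin m, ENNReal.ofReal (1 - Real.exp (-t)) :=
          this.trans (Finset.prod_congr rfl fun i _ => h0 i)
      _ = _ := by simp
  have hlt : ENNReal.ofReal (1 - Real.exp (-t)) < 1 := by
    rw [ENNReal.ofReal_lt_one]
    linarith [Real.exp_pos (-t)]
  exact le_antisymm (ge_of_tendsto' (ENNReal.tendsto_pow_atTop_nhds_zero_of_lt_one hlt) hle)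
    zero_le

/-- Almost surely, the product of the quenched laws of finitely many particles is given exactly by
every sufficiently fine dyadic discretization. -/
theorem ae_eventually_integral_pi_K (henv : IsPoissonEnvironment P μ env) {N : ℕ} {t : ℝ}
    (ht : 0 ≤ t) (x : Fin N → ℤ) :
    ∀ᵐ ω ∂P, ∀ᶠ k : ℕ in atTop, ∀ (f : (Fin N → ℤ) → ℝ) (C : ℝ), (∀ y, |f y| ≤ C) →
      ∫ y, f y ∂(Measure.pi fun i => (env ω).K 0 t (x i)) =
        pathOp ((env ω).cellWeight (t / 2 ^ k) 0) (2 ^ k) f x := by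
  obtain ⟨U, hU⟩ := Finite.exists_le x
  obtain ⟨L, hL⟩ := Finite.exists_ge x
  have hright := henv.ae_exists_quiet ht (σ := fun i => U + i) fun i j hij => by simpa using hij
  have hleft := henv.ae_exists_quiet ht (σ := fun i => L - i) fun i j hij => by simpa using hij
  have hslab := ae_all_iff.2 fun a => ae_all_iff.2 fun b =>
    henv.ae_eventually_count_slab_le_one ht a b
  filter_upwards [hright, hleft, hslab] with ω ⟨i, hi⟩ ⟨i', hi'⟩ hω
  filter_upwards [hω (L - i') (U + i)] with k hk f C hf
  have htk : (0 : ℝ) + ((2 ^ k : ℕ) : ℝ) * (t / 2 ^ k) = t := by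
    push_cast
    field_simp
    ring
  have key := (env ω).integral_pi_K_eq_pathOp (h := t / 2 ^ k) (by positivity)
    (a := L - i') (b := U + i) (2 ^ k) 0 (by rwa [htk]) (by rwa [htk]) hk hf x fun j =>
      ⟨by have := hL j; lia, by have := hU j; lia⟩
  rwa [htk] at key

end IsPoissonEnvironment

end Environment

/-! ### Averaging over independent time slabs -/

lemma measurable_prod_weight {Ω : Type*} [MeasurableSpace Ω] {N : ℕ} {z : Ω → ℤ → SignType → ℝ}
    (hz : ∀ y, Measurable fun ω => z ω y) (x : Fin N → ℤ) (v : Fin N → SignType) :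
    Measurable fun ω => ∏ i, z ω (x i) (v i) :=
  Finset.measurable_fun_prod _ fun i _ => measurable_pi_iff.1 (hz (x i)) (v i)

lemma measurable_stepOp {Ω : Type*} [MeasurableSpace Ω] {N : ℕ} {z : Ω → ℤ → SignType → ℝ}
    (hz : ∀ y, Measurable fun ω => z ω y) {f : Ω → (Fin N → ℤ) → ℝ}
    (hf : ∀ x, Measurable fun ω => f ω x) (x : Fin N → ℤ) :
    Measurable fun ω => stepOp (z ω) (f ω) x :=
  Finset.measurable_fun_sum _ fun v _ => (measurable_prod_weight hz x v).mul (hf _)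

lemma measurable_pathOp {Ω : Type*} [MeasurableSpace Ω] {N : ℕ} {z : Ω → ℕ → ℤ → SignType → ℝ}
    (hz : ∀ j y, Measurable fun ω => z ω j y) (n : ℕ) (f : (Fin N → ℤ) → ℝ) (x : Fin N → ℤ) :
    Measurable fun ω => pathOp (z ω) n f x := by
  induction n generalizing z x with
  | zero => exact measurable_const
  | succ n ih =>
    exact measurable_stepOp (hz 0) (fun y => ih (z := fun ω j => z ω (j + 1))
      (fun j => hz (j + 1)) y) x

lemma IsWeight.le_one {w : SignType → ℝ} (hw : IsWeight w) (v : SignType) : w v ≤ 1 :=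
  hw.2 ▸ Finset.single_le_sum (fun v _ => hw.1 v) (Finset.mem_univ v)

lemma abs_prod_weight_le_one {N : ℕ} {z : ℤ → SignType → ℝ} (hz : ∀ y, IsWeight (z y))
    (x : Fin N → ℤ) (v : Fin N → SignType) : |∏ i, z (x i) (v i)| ≤ 1 := by
  rw [abs_of_nonneg (Finset.prod_nonneg fun i _ => (hz _).1 _)]
  exact Finset.prod_le_one (fun i _ => (hz _).1 _) fun i _ => (hz _).le_one _

/-- The average of one step with the random weights `z`. -/
noncomputable def meanStep {Ω : Type*} [MeasurableSpace Ω] (P : Measure Ω) {N : ℕ}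
    (z : Ω → ℤ → SignType → ℝ) (f : (Fin N → ℤ) → ℝ) (x : Fin N → ℤ) : ℝ :=
  ∫ ω, stepOp (z ω) f x ∂P

section IndependentWeights

variable {Ω : Type*} [MeasurableSpace Ω] {P : Measure Ω} [IsProbabilityMeasure P]
  {z : Ω → ℕ → ℤ → SignType → ℝ}

lemma integrable_prod_weight {N : ℕ} {w : Ω → ℤ → SignType → ℝ} (hw : ∀ ω y, IsWeight (w ω y))
    (hwm : ∀ y, Measurable fun ω => w ω y) (x : Fin N → ℤ) (v : Fin N → SignType) :
    Integrable (fun ω => ∏ i, w ω (x i) (v i)) P :=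
  Integrable.of_bound (measurable_prod_weight hwm x v).aestronglyMeasurable 1
    (Eventually.of_forall fun ω => abs_prod_weight_le_one (hw ω) x v)

lemma integrable_stepOp {N : ℕ} {w : Ω → ℤ → SignType → ℝ} (hw : ∀ ω y, IsWeight (w ω y))
    (hwm : ∀ y, Measurable fun ω => w ω y) {f : (Fin N → ℤ) → ℝ} {C : ℝ} (hf : ∀ x, |f x| ≤ C)
    (x : Fin N → ℤ) : Integrable (fun ω => stepOp (w ω) f x) P :=
  Integrable.of_bound (measurable_stepOp (f := fun _ => f) hwm
    (fun _ => measurable_const) x).aestronglyMeasurable C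
    (Eventually.of_forall fun ω => abs_stepOp_le (hw ω) hf x)

lemma meanStep_eq_sum {N : ℕ} {w : Ω → ℤ → SignType → ℝ} (hw : ∀ ω y, IsWeight (w ω y))
    (hwm : ∀ y, Measurable fun ω => w ω y) (f : (Fin N → ℤ) → ℝ) (x : Fin N → ℤ) :
    meanStep P w f x = ∑ v : Fin N → SignType,
      (∫ ω, ∏ i, w ω (x i) (v i) ∂P) * f (x + fun i => (v i : ℤ)) := by
  unfold meanStep stepOp
  rw [integral_finsetSum _ fun v _ => (integrable_prod_weight hw hwm x v).mul_const _]
  exact Finset.sum_congr rfl fun v _ => integral_mul_const _ _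

/-- Since the slabs are independent and identically distributed, averaging the composition of `n`
random steps gives the `n`-th iterate of the averaged step. -/
theorem integral_pathOp {N : ℕ} (hz : ∀ ω j y, IsWeight (z ω j y))
    (hzm : ∀ j y, Measurable fun ω => z ω j y)
    (hind : iIndepFun (fun (c : ℕ × ℤ) ω => z ω c.1 c.2) P)
    (hlaw : ∀ j y, P.map (fun ω => z ω j y) = P.map (fun ω => z ω 0 y))
    {f : (Fin N → ℤ) → ℝ} {C : ℝ} (hf : ∀ x, |f x| ≤ C) (n j : ℕ) (x : Fin N → ℤ) :
    ∫ ω, pathOp (fun i => z ω (j + i)) n f x ∂P = (meanStep P fun ω => z ω 0)^[n] f x := by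
  induction n generalizing j x with
  | zero => simp [pathOp]
  | succ n ih =>
    rw [Function.iterate_succ_apply', meanStep_eq_sum (fun ω => hz ω 0) (hzm 0)]
    have hshift : ∀ ω, (fun i => z ω (j + (i + 1))) = fun i => z ω (j + 1 + i) := fun ω =>
      funext fun i => by rw [add_assoc, add_comm 1 i]
    simp only [pathOp, add_zero, hshift, stepOp]
    -- the slab `j` has the same law as the slab `0`
    have hslab : ∀ v : Fin N → SignType, ∫ ω, ∏ i, z ω j (x i) (v i) ∂P =
        ∫ ω, ∏ i, z ω 0 (x i) (v i) ∂P := fun v => by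
      have hmap : ∀ j, P.map (fun ω y => z ω j y) =
          Measure.infinitePi fun y => P.map fun ω => z ω 0 y := fun j => by
        rw [(iIndepFun_iff_map_fun_eq_infinitePi_map fun y => hzm j y).1
          (hind.precomp (g := fun y => (j, y)) fun y y' h => (Prod.ext_iff.1 h).2)]
        simp_rw [hlaw j]
      have hg : Measurable fun w : ℤ → SignType → ℝ => ∏ i, w (x i) (v i) :=
        measurable_prod_weight (fun y => measurable_pi_apply y) x v
      have hint : ∀ j, ∫ ω, ∏ i, z ω j (x i) (v i) ∂P =
          ∫ w, ∏ i, w (x i) (v i) ∂(P.map fun ω y => z ω j y) := fun j =>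
        (integral_map (measurable_pi_iff.2 fun y => hzm j y).aemeasurable
          hg.aestronglyMeasurable).symm
      rw [hint j, hint 0, hmap j, hmap 0]
    -- the slab `j` is independent of the later slabs
    set 𝓕 : ℕ × ℤ → MeasurableSpace Ω := fun c =>
      MeasurableSpace.comap (fun ω => z ω c.1 c.2) inferInstance
    have hle : ∀ c, 𝓕 c ≤ ‹MeasurableSpace Ω› := fun c => (hzm c.1 c.2).comap_le
    have hmeas : ∀ (S : Set (ℕ × ℤ)) (k : ℕ) (y : ℤ), (k, y) ∈ S →
        Measurable[⨆ c ∈ S, 𝓕 c] fun ω => z ω k y := fun S k y hc =>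
      Measurable.mono (comap_measurable _) (le_iSup₂_of_le (k, y) hc le_rfl) le_rfl
    obtain ⟨S, hS⟩ : ∃ S : Set (ℕ × ℤ), ∀ c, c ∈ S ↔ c.1 = j := ⟨{c | c.1 = j}, fun c => Iff.rfl⟩
    obtain ⟨T, hT⟩ : ∃ T : Set (ℕ × ℤ), ∀ c, c ∈ T ↔ j + 1 ≤ c.1 :=
      ⟨{c | j + 1 ≤ c.1}, fun c => Iff.rfl⟩
    have hindep := indep_iSup_of_disjoint hle hind.iIndep (S := S) (T := T)
      (Set.disjoint_left.2 fun c hc hc' => by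
        have h1 := (hS c).1 hc
        have h2 := (hT c).1 hc'
        lia)
    have hX : ∀ v : Fin N → SignType,
        Measurable[⨆ c ∈ S, 𝓕 c] fun ω => ∏ i, z ω j (x i) (v i) :=
      @measurable_prod_weight Ω (⨆ c ∈ S, 𝓕 c) N (fun ω => z ω j)
        (fun y => hmeas S j y ((hS _).2 rfl)) x
    have hY : ∀ y : Fin N → ℤ,
        Measurable[⨆ c ∈ T, 𝓕 c] fun ω => pathOp (fun i => z ω (j + 1 + i)) n f y :=
      @measurable_pathOp Ω (⨆ c ∈ T, 𝓕 c) N (fun ω i => z ω (j + 1 + i))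
        (fun i y => hmeas T (j + 1 + i) y ((hT _).2 (Nat.le_add_right _ _))) n f
    have hXY : ∀ v : Fin N → SignType, IndepFun (fun ω => ∏ i, z ω j (x i) (v i))
        (fun ω => pathOp (fun i => z ω (j + 1 + i)) n f (x + fun i => (v i : ℤ))) P := fun v => by
      rw [IndepFun_iff_Indep]
      exact indep_of_indep_of_le_left (indep_of_indep_of_le_right hindep (hY _).comap_le)
        (hX v).comap_le
    have hYm : ∀ y, Measurable fun ω => pathOp (fun i => z ω (j + 1 + i)) n f y := fun y =>
      measurable_pathOp (z := fun ω i => z ω (j + 1 + i)) (fun i y => hzm _ y) n f y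
    have hYi : ∀ y, Integrable (fun ω => pathOp (fun i => z ω (j + 1 + i)) n f y) P := fun y =>
      Integrable.of_bound (hYm y).aestronglyMeasurable C
        (Eventually.of_forall fun ω => abs_pathOp_le (fun i => hz ω _) n hf y)
    have hXi := fun v => integrable_prod_weight (P := P) (fun ω => hz ω j) (hzm j) x v
    have hXYi : ∀ v : Fin N → SignType, Integrable (fun ω => (∏ i, z ω j (x i) (v i)) *
        pathOp (fun i => z ω (j + 1 + i)) n f (x + fun i => (v i : ℤ))) P := fun v =>
      (hXY v).integrable_mul (hXi v) (hYi _)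
    rw [integral_finsetSum _ fun v _ => hXYi v]
    refine Finset.sum_congr rfl fun v _ => ?_
    have := (hXY v).integral_mul_eq_mul_integral (hXi v).aestronglyMeasurable
      (hYi _).aestronglyMeasurable
    simp only [Pi.mul_apply] at this
    rw [this, hslab, ih]

end IndependentWeights

/-! ### One step to first order -/

/-- The increments of `N` particles of which those in `I` jump up, those in `J` jump down, and the
others stay. -/
def signs {N : ℕ} (I J : Finset (Fin N)) : Fin N → SignType :=
  fun i => if i ∈ I then 1 else if i ∈ J then -1 else 0

lemma coe_signs {N : ℕ} (I J : Finset (Fin N)) : (fun i => (signs I J i : ℤ)) = vec I J := by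
  funext i
  unfold signs vec
  split_ifs <;> rfl

/-- The pairs of disjoint sets with union `F`. -/
def splitPairs {N : ℕ} (F : Finset (Fin N)) : Finset (Finset (Fin N) × Finset (Fin N)) :=
  {IJ | Disjoint IJ.1 IJ.2 ∧ IJ.1 ∪ IJ.2 = F}

lemma mem_splitPairs {N : ℕ} {F : Finset (Fin N)} {IJ : Finset (Fin N) × Finset (Fin N)} :
    IJ ∈ splitPairs F ↔ Disjoint IJ.1 IJ.2 ∧ IJ.1 ∪ IJ.2 = F := by
  simp [splitPairs]

lemma signs_eq_one_iff {N : ℕ} {I J : Finset (Fin N)} (i : Fin N) : signs I J i = 1 ↔ i ∈ I := by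
  unfold signs
  split_ifs with h h' <;> simp [h]

lemma signs_eq_neg_one_iff {N : ℕ} {I J : Finset (Fin N)} (h : Disjoint I J) (i : Fin N) :
    signs I J i = -1 ↔ i ∈ J := by
  unfold signs
  split_ifs with h1 h2
  · exact iff_of_false (by decide) (Finset.disjoint_left.1 h h1)
  · simp [h2]
  · simp [h2]

/-- If only the site `y` carries a mark, then the particles at `y` split according to the mark. -/
lemma stepOp_update_jump {N : ℕ} (y : ℤ) (r : unitInterval) (f : (Fin N → ℤ) → ℝ)
    (x : Fin N → ℤ) :
    stepOp (Function.update (fun _ => stay) y (jump r)) f x =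
      ∑ IJ ∈ splitPairs {i | x i = y}, (r : ℝ) ^ IJ.1.card * (1 - r) ^ IJ.2.card *
        f (x + vec IJ.1 IJ.2) := by
  symm
  refine Finset.sum_of_injOn (fun IJ => signs IJ.1 IJ.2) ?_ (fun _ _ => Finset.mem_coe.2
    (Finset.mem_univ _)) ?_ ?_
  · rintro ⟨I, J⟩ hIJ ⟨I', J'⟩ hIJ' heq
    have hd := (mem_splitPairs.1 (Finset.mem_coe.1 hIJ)).1
    have hd' := (mem_splitPairs.1 (Finset.mem_coe.1 hIJ')).1
    simp only at heq hd hd'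
    ext i
    · rw [← signs_eq_one_iff (J := J), heq, signs_eq_one_iff]
    · rw [← signs_eq_neg_one_iff hd, heq, signs_eq_neg_one_iff hd']
  · intro v _ hv
    refine mul_eq_zero_of_left ?_ _
    by_contra hne
    have hfac := fun i => Finset.prod_ne_zero_iff.1 hne i (Finset.mem_univ i)
    have hv0 : ∀ i, v i ≠ 0 ↔ x i = y := fun i => by
      have := hfac i
      by_cases hi : x i = y
      · refine iff_of_true (fun h0 => this ?_) hi
        rw [hi, Function.update_self, h0]
        rfl
      · rw [Function.update_of_ne hi] at this
        refine iff_of_false (fun h0 => this ?_) hi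
        exact Pi.single_eq_of_ne h0 1
    refine hv ⟨(({i | v i = 1} : Finset (Fin N)), ({i | v i = -1} : Finset (Fin N))), ?_, ?_⟩
    · refine Finset.mem_coe.2 (mem_splitPairs.2 ⟨?_, ?_⟩)
      · rw [Finset.disjoint_left]
        intro i h1 h2
        simp only [Finset.mem_filter_univ] at h1 h2
        rw [h1] at h2
        exact absurd h2 (by decide)
      · ext i
        simp only [Finset.mem_union, Finset.mem_filter_univ]
        rw [← hv0 i]
        generalize v i = s
        cases s <;> decide
    · funext i
      simp only [signs, Finset.mem_filter_univ]
      generalize v i = s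
      cases s <;> decide
  · rintro ⟨I, J⟩ hIJ
    obtain ⟨hd, hU⟩ := mem_splitPairs.1 hIJ
    simp only at hd hU
    rw [← coe_signs]
    congr 1
    have hmem : ∀ i, x i = y ↔ i ∈ I ∨ i ∈ J := fun i => by
      rw [← Finset.mem_union, hU, Finset.mem_filter_univ]
    have hfac : ∀ i, Function.update (fun _ : ℤ => stay) y (jump r) (x i) (signs I J i) =
        (if i ∈ I then (r : ℝ) else 1) * (if i ∈ J then 1 - (r : ℝ) else 1) := fun i => by
      by_cases hI : i ∈ I
      · rw [(hmem i).2 (Or.inl hI), Function.update_self, (signs_eq_one_iff i).2 hI, if_pos hI,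
          if_neg (Finset.disjoint_left.1 hd hI), mul_one]
        rfl
      · by_cases hJ : i ∈ J
        · rw [(hmem i).2 (Or.inr hJ), Function.update_self, (signs_eq_neg_one_iff hd i).2 hJ,
            if_neg hI, if_pos hJ, one_mul]
          rfl
        · rw [Function.update_of_ne (fun h => ((hmem i).1 h).elim hI hJ)]
          simp [signs, hI, hJ, stay]
    rw [Finset.prod_congr rfl fun i _ => hfac i, Finset.prod_mul_distrib]
    simp [Finset.prod_ite_mem]

lemma stepOp_congr {N : ℕ} {z z' : ℤ → SignType → ℝ} {x : Fin N → ℤ}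
    (h : ∀ i, z (x i) = z' (x i)) (f : (Fin N → ℤ) → ℝ) : stepOp z f x = stepOp z' f x := by
  simp only [stepOp, h]

lemma stepOp_stay {N : ℕ} (f : (Fin N → ℤ) → ℝ) (x : Fin N → ℤ) :
    stepOp (fun _ => stay) f x = f x := by
  rw [stepOp, Finset.sum_eq_single 0]
  · have : (fun i => (((0 : Fin N → SignType) i : SignType) : ℤ)) = 0 := funext fun i => by simp
    rw [this]
    simp [stay]
  · intro v _ hv
    obtain ⟨i, hi⟩ := Function.ne_iff.1 hv
    rw [Finset.prod_eq_zero (Finset.mem_univ i) (Pi.single_eq_of_ne hi 1), zero_mul]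
  · simp

/-- The generator as a sum over occupied sites. -/
lemma generator_eq_sum_image {N : ℕ} (p : ℕ → ℕ → ℝ) (f : (Fin N → ℤ) → ℝ) (x : Fin N → ℤ) :
    generator N p f x = ∑ y ∈ Finset.univ.image x, ∑ IJ ∈ splitPairs {i | x i = y},
      p IJ.1.card IJ.2.card * (f (x + vec IJ.1 IJ.2) - f x) := by
  have hset : splittings x =
      (Finset.univ.image x).biUnion fun y => splitPairs {i | x i = y} := by
    ext IJ
    have hspl : IJ ∈ splittings x ↔ Disjoint IJ.1 IJ.2 ∧ ∃ k, IJ.1 ∪ IJ.2 = component x k := by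
      unfold splittings
      rw [Finset.mem_filter]
      simp
    rw [hspl]
    simp [mem_splitPairs, component]
  rw [generator, hset, Finset.sum_biUnion]
  intro y hy y' hy' hne
  obtain ⟨i, -, hi⟩ := Finset.mem_image.1 (Finset.mem_coe.1 hy)
  refine Finset.disjoint_left.2 fun IJ h h' => hne ?_
  have hU := (mem_splitPairs.1 h).2.symm.trans (mem_splitPairs.1 h').2
  have hi' : i ∈ ({i | x i = y'} : Finset (Fin N)) := hU ▸ (Finset.mem_filter_univ i).2 hi
  exact hi.symm.trans ((Finset.mem_filter_univ i).1 hi')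

lemma isWeight_update {w : SignType → ℝ} (hw : IsWeight w) (y y' : ℤ) :
    IsWeight (Function.update (fun _ => stay) y w y') := by
  rw [Function.update_apply]
  split_ifs
  · exact hw
  · exact isWeight_stay

lemma stepOp_update_stay {N : ℕ} (y : ℤ) (f : (Fin N → ℤ) → ℝ) (x : Fin N → ℤ) :
    stepOp (Function.update (fun _ => stay) y stay) f x = f x := by
  rw [show Function.update (fun _ : ℤ => stay) y stay = fun _ => stay from
    Function.update_eq_self y _, stepOp_stay]

open Classical in
/-- The effects of the occupied sites add up, unless two of them carry marks. -/
lemma abs_stepOp_sub_sum_le {N : ℕ} {w : ℤ → SignType → ℝ} (hw : ∀ y, IsWeight (w y))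
    {f : (Fin N → ℤ) → ℝ} {C : ℝ} (hf : ∀ x, |f x| ≤ C) {x : Fin N → ℤ} (hx : f x = 0) :
    |stepOp w f x - ∑ y ∈ Finset.univ.image x,
        stepOp (Function.update (fun _ => stay) y (w y)) f x| ≤
      (N + 1) * C * ∑ q ∈ (Finset.univ.image x).offDiag,
        if w q.1 ≠ stay ∧ w q.2 ≠ stay then (1 : ℝ) else 0 := by
  have hC : 0 ≤ C := (abs_nonneg _).trans (hf x)
  set D := Finset.univ.image x
  have hD : (D.card : ℝ) ≤ N := by
    have : D.card ≤ N := Finset.card_image_le.trans (by simp)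
    exact_mod_cast this
  have hnn : ∀ q : ℤ × ℤ, 0 ≤ if w q.1 ≠ stay ∧ w q.2 ≠ stay then (1 : ℝ) else 0 := fun q => by
    positivity
  have hstay : ∀ y, w y = stay → stepOp (Function.update (fun _ => stay) y (w y)) f x = 0 :=
    fun y h => by rw [h, stepOp_update_stay, hx]
  by_cases h2 : ∃ y ∈ D, ∃ y' ∈ D, y ≠ y' ∧ w y ≠ stay ∧ w y' ≠ stay
  · obtain ⟨y, hy, y', hy', hne, h⟩ := h2
    have hge := Finset.single_le_sum (fun q _ => hnn q)
      (Finset.mem_offDiag.2 ⟨hy, hy', hne⟩ : (y, y') ∈ D.offDiag)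
    rw [if_pos h] at hge
    have hsum : |∑ y ∈ D, stepOp (Function.update (fun _ => stay) y (w y)) f x| ≤ N * C := by
      refine (Finset.abs_sum_le_sum_abs _ _).trans ((Finset.sum_le_card_nsmul _ _ C fun y _ =>
        abs_stepOp_le (isWeight_update (hw y) y) hf x).trans ?_)
      rw [nsmul_eq_mul]
      gcongr
    calc _ ≤ C + N * C := (abs_sub _ _).trans (add_le_add (abs_stepOp_le hw hf x) hsum)
      _ = (N + 1) * C * 1 := by ring
      _ ≤ _ := by gcongr
  · push Not at h2
    have hxD : ∀ i, x i ∈ D := fun i => Finset.mem_image_of_mem x (Finset.mem_univ i)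
    have hzero : stepOp w f x -
        ∑ y ∈ D, stepOp (Function.update (fun _ => stay) y (w y)) f x = 0 := by
      by_cases h1 : ∃ y ∈ D, w y ≠ stay
      · obtain ⟨y, hy, h⟩ := h1
        have hother : ∀ y' ∈ D, y' ≠ y → w y' = stay := fun y' hy' hne =>
          h2 y hy y' hy' hne.symm h
        rw [Finset.sum_eq_single y (fun y' hy' hne => hstay y' (hother y' hy' hne))
          (fun h => absurd hy h), sub_eq_zero]
        refine stepOp_congr (fun i => ?_) f
        by_cases hi : x i = y
        · rw [hi, Function.update_self]
        · rw [Function.update_of_ne hi, hother _ (hxD i) hi]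
      · push Not at h1
        rw [Finset.sum_eq_zero fun y hy => hstay y (h1 y hy), sub_zero,
          stepOp_congr (z' := fun _ => stay) (fun i => h1 _ (hxD i)), stepOp_stay, hx]
    rw [hzero, abs_zero]
    exact mul_nonneg (by positivity) (Finset.sum_nonneg fun q _ => hnn q)

section OneStep

variable {Ω : Type*} [MeasurableSpace Ω] {P : Measure Ω} {μ : Measure unitInterval}
  [IsProbabilityMeasure μ] {N : ℕ}

/-- The mean effect of a single occupied site `y`. -/
lemma integral_stepOp_update {w : Ω → SignType → ℝ} (hwm : Measurable w) {a : ℝ} (ha : 0 ≤ a)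
    (hlaw : P.map w =
      ENNReal.ofReal (1 - a) • Measure.dirac stay + ENNReal.ofReal a • μ.map jump)
    {f : (Fin N → ℤ) → ℝ} {C : ℝ} (hf : ∀ x, |f x| ≤ C) (y : ℤ) {x : Fin N → ℤ} (hx : f x = 0) :
    ∫ ω, stepOp (Function.update (fun _ => stay) y (w ω)) f x ∂P =
      a * ∑ IJ ∈ splitPairs {i | x i = y}, splitRate μ IJ.1.card IJ.2.card *
        (f (x + vec IJ.1 IJ.2) - f x) := by
  set g : (SignType → ℝ) → ℝ := fun u => stepOp (Function.update (fun _ => stay) y u) f x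
  have hg : Measurable g := by
    refine measurable_stepOp (z := fun u => Function.update (fun _ => stay) y u)
      (f := fun _ => f) (fun y' => ?_) (fun _ => measurable_const) x
    simp only [Function.update_apply]
    split_ifs
    · exact measurable_id
    · exact measurable_const
  have hg0 : g stay = 0 := by
    simp only [g, stepOp_update_stay, hx]
  have hgj : ∀ r, |g (jump r)| ≤ C := fun r =>
    abs_stepOp_le (isWeight_update (isWeight_jump r) y) hf x
  have hint : Integrable g (μ.map jump) :=
    (integrable_map_measure hg.aestronglyMeasurable measurable_jump.aemeasurable).2
      (Integrable.of_bound (hg.comp measurable_jump).aestronglyMeasurable C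
        (Eventually.of_forall fun r => hgj r))
  have hintd : Integrable g (Measure.dirac stay) := integrable_dirac (by simp)
  calc ∫ ω, g (w ω) ∂P = ∫ u, g u ∂(P.map w) :=
        (integral_map hwm.aemeasurable hg.aestronglyMeasurable).symm
    _ = a * ∫ r, g (jump r) ∂μ := by
        rw [hlaw, integral_add_measure (hintd.smul_measure ENNReal.ofReal_ne_top)
          (hint.smul_measure ENNReal.ofReal_ne_top), integral_smul_measure, integral_smul_measure,
          integral_dirac, hg0, smul_zero, zero_add, ENNReal.toReal_ofReal ha, smul_eq_mul,
          integral_map measurable_jump.aemeasurable hg.aestronglyMeasurable]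
    _ = _ := by
        congr 1
        simp only [g, stepOp_update_jump, hx, sub_zero]
        rw [integral_finsetSum]
        · exact Finset.sum_congr rfl fun IJ _ => integral_mul_const _ _
        · intro IJ _
          refine Integrable.mul_const
            (Integrable.of_bound ?_ 1 (Eventually.of_forall fun r => ?_)) _
          · exact Measurable.aestronglyMeasurable (by fun_prop)
          · have h0 := r.2.1
            have h1 := r.2.2
            rw [Real.norm_eq_abs, abs_of_nonneg (mul_nonneg (pow_nonneg h0 _)
              (pow_nonneg (sub_nonneg.2 h1) _))]
            exact mul_le_one₀ (pow_le_one₀ h0 h1) (pow_nonneg (sub_nonneg.2 h1) _)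
              (pow_le_one₀ (sub_nonneg.2 h1) (by linarith))

variable [IsProbabilityMeasure P]

open Classical in
/-- The expected number of pairs of sites in `D` that both carry marks is of order `a ^ 2`. -/
lemma integral_sum_offDiag_le {w : Ω → ℤ → SignType → ℝ}
    (hwm : ∀ y, Measurable fun ω => w ω y) (hind : iIndepFun (fun y ω => w ω y) P)
    {a : ℝ} (ha : 0 ≤ a) (hlaw : ∀ y, P.map (fun ω => w ω y) =
      ENNReal.ofReal (1 - a) • Measure.dirac stay + ENNReal.ofReal a • μ.map jump)
    (D : Finset ℤ) :
    Integrable (fun ω => ∑ q ∈ D.offDiag,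
        if w ω q.1 ≠ stay ∧ w ω q.2 ≠ stay then (1 : ℝ) else 0) P ∧
      ∫ ω, (∑ q ∈ D.offDiag, if w ω q.1 ≠ stay ∧ w ω q.2 ≠ stay then (1 : ℝ) else 0) ∂P ≤
        D.card ^ 2 * a ^ 2 := by
  have hns : MeasurableSet ({stay}ᶜ : Set (SignType → ℝ)) := (measurableSet_singleton _).compl
  have hone : ∀ y, P ((fun ω => w ω y) ⁻¹' {stay}ᶜ) ≤ ENNReal.ofReal a := fun y => by
    have : IsProbabilityMeasure (μ.map jump) :=
      Measure.isProbabilityMeasure_map measurable_jump.aemeasurable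
    rw [← Measure.map_apply (hwm y) hns, hlaw]
    simp only [Measure.coe_add, Measure.coe_smul, Pi.add_apply, Pi.smul_apply, smul_eq_mul,
      Measure.dirac_apply' _ hns]
    simp only [Set.mem_compl_iff, Set.mem_singleton_iff, not_true_eq_false, not_false_eq_true,
      Set.indicator_of_notMem, mul_zero, zero_add]
    exact mul_le_of_le_one_right zero_le prob_le_one
  have hpairm : ∀ q : ℤ × ℤ, MeasurableSet {ω | w ω q.1 ≠ stay ∧ w ω q.2 ≠ stay} := fun q =>
    (hwm q.1 hns).inter (hwm q.2 hns)
  have hpair : ∀ q ∈ D.offDiag, P.real {ω | w ω q.1 ≠ stay ∧ w ω q.2 ≠ stay} ≤ a ^ 2 := by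
    intro q hq
    have := (hind.indepFun (Finset.mem_offDiag.1 hq).2.2).measure_inter_preimage_eq_mul _ _ hns hns
    refine ENNReal.toReal_le_of_le_ofReal (by positivity) ?_
    rw [pow_two, ENNReal.ofReal_mul ha]
    exact this.trans_le (mul_le_mul' (hone _) (hone _))
  have hind1 : ∀ q : ℤ × ℤ, (fun ω => if w ω q.1 ≠ stay ∧ w ω q.2 ≠ stay then (1 : ℝ) else 0) =
      {ω | w ω q.1 ≠ stay ∧ w ω q.2 ≠ stay}.indicator fun _ => (1 : ℝ) := fun q => by
    funext ω
    rw [Set.indicator_apply]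
    rfl
  have hi : ∀ q : ℤ × ℤ, Integrable
      (fun ω => if w ω q.1 ≠ stay ∧ w ω q.2 ≠ stay then (1 : ℝ) else 0) P := fun q => by
    rw [hind1]
    exact (integrable_const _).indicator (hpairm q)
  refine ⟨integrable_finsetSum _ fun q _ => hi q, ?_⟩
  rw [integral_finsetSum _ fun q _ => hi q]
  calc _ ≤ ∑ q ∈ D.offDiag, a ^ 2 := Finset.sum_le_sum fun q hq => by
        rw [hind1, integral_indicator_const _ (hpairm q), smul_eq_mul, mul_one]
        exact hpair q hq
    _ ≤ D.card ^ 2 * a ^ 2 := by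
        rw [Finset.sum_const, nsmul_eq_mul]
        gcongr
        rw [Finset.offDiag_card, pow_two]
        exact_mod_cast Nat.sub_le _ _

/-- To first order in the probability `a` that a site carries a mark, the averaged step is the
generator: the effect of several sites carrying marks at once is of order `a ^ 2`. -/
theorem abs_meanStep_sub_le {w : Ω → ℤ → SignType → ℝ} (hw : ∀ ω y, IsWeight (w ω y))
    (hwm : ∀ y, Measurable fun ω => w ω y) (hind : iIndepFun (fun y ω => w ω y) P)
    {a : ℝ} (ha : 0 ≤ a) (hlaw : ∀ y, P.map (fun ω => w ω y) =
      ENNReal.ofReal (1 - a) • Measure.dirac stay + ENNReal.ofReal a • μ.map jump)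
    {f : (Fin N → ℤ) → ℝ} {C : ℝ} (hf : ∀ x, |f x| ≤ C) (x : Fin N → ℤ) :
    |meanStep P w f x - f x - a * generator N (splitRate μ) f x| ≤
      2 * (N + 1) * N ^ 2 * C * a ^ 2 := by
  have hC : 0 ≤ C := (abs_nonneg _).trans (hf x)
  set D := Finset.univ.image x
  have hD : (D.card : ℝ) ≤ N := by
    have : D.card ≤ N := Finset.card_image_le.trans (by simp)
    exact_mod_cast this
  -- it suffices to consider `F = f - f x`, which vanishes at `x`
  set F : (Fin N → ℤ) → ℝ := fun y => f y - f x
  have hF : ∀ y, |F y| ≤ 2 * C := fun y =>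
    (abs_sub _ _).trans (by linarith [hf y, hf x])
  have hFx : F x = 0 := sub_self _
  have hstepF : ∀ ω, stepOp (w ω) F x = stepOp (w ω) f x - f x := fun ω => by
    simp only [stepOp, F, mul_sub, Finset.sum_sub_distrib, ← Finset.sum_mul,
      sum_prod_eq_one fun i => hw ω (x i), one_mul]
  set solo : ℤ → Ω → ℝ := fun y ω => stepOp (Function.update (fun _ => stay) y (w ω y)) F x
  obtain ⟨htwoi, htwo⟩ := integral_sum_offDiag_le hwm hind ha hlaw D
  have hintStep : Integrable (fun ω => stepOp (w ω) F x) P := integrable_stepOp hw hwm hF x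
  have hintf : Integrable (fun ω => stepOp (w ω) f x) P := integrable_stepOp hw hwm hf x
  have hintsolo : ∀ y, Integrable (solo y) P := fun y =>
    integrable_stepOp (fun ω => isWeight_update (hw ω y) y) (fun y' => by
      simp only [Function.update_apply]
      split_ifs
      · exact hwm y
      · exact measurable_const) hF x
  have hmain : meanStep P w f x - f x - a * generator N (splitRate μ) f x =
      ∫ ω, (stepOp (w ω) F x - ∑ y ∈ D, solo y ω) ∂P := by
    rw [integral_sub hintStep (integrable_finsetSum _ fun y _ => hintsolo y),
      integral_finsetSum _ fun y _ => hintsolo y]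
    congr 1
    · simp_rw [hstepF]
      rw [integral_sub hintf (integrable_const _)]
      simp [meanStep]
    · rw [generator_eq_sum_image, Finset.mul_sum]
      refine Finset.sum_congr rfl fun y _ => ?_
      rw [integral_stepOp_update (hwm y) ha (hlaw y) hF y hFx]
      simp [F]
  rw [hmain]
  calc _ ≤ ∫ ω, |stepOp (w ω) F x - ∑ y ∈ D, solo y ω| ∂P := abs_integral_le_integral_abs
    _ ≤ _ := integral_mono (hintStep.sub (integrable_finsetSum _ fun y _ => hintsolo y)).abs
          (htwoi.const_mul ((N + 1) * (2 * C))) fun ω => abs_stepOp_sub_sum_le (hw ω) hF hFx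
    _ ≤ (N + 1) * (2 * C) * (N ^ 2 * a ^ 2) := by
        rw [integral_const_mul]
        refine mul_le_mul_of_nonneg_left (htwo.trans ?_) (by positivity)
        gcongr
    _ = _ := by ring

end OneStep

/-! ### Exponential limit of powers in a Banach algebra -/

section BanachAlgebra

variable {A : Type*} [NormedRing A]

lemma norm_pow_sub_pow_le {a b : A} {M : ℝ} (ha : ‖a‖ ≤ 1) (n : ℕ)
    (hb : ∀ k < n, ‖b ^ k‖ ≤ M) : ‖a ^ n - b ^ n‖ ≤ n * (‖a - b‖ * M) := by
  induction n with
  | zero => simp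
  | succ n ih =>
    have hsplit : a ^ (n + 1) - b ^ (n + 1) = a * (a ^ n - b ^ n) + (a - b) * b ^ n := by
      rw [pow_succ', pow_succ']
      noncomm_ring
    calc ‖a ^ (n + 1) - b ^ (n + 1)‖ ≤ ‖a‖ * ‖a ^ n - b ^ n‖ + ‖a - b‖ * ‖b ^ n‖ := by
          rw [hsplit]
          exact (norm_add_le _ _).trans (add_le_add (norm_mul_le _ _) (norm_mul_le _ _))
      _ ≤ 1 * (n * (‖a - b‖ * M)) + ‖a - b‖ * M := by
          gcongr
          · exact ih fun k hk => hb k (hk.trans n.lt_succ_self)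
          · exact hb n n.lt_succ_self
      _ = _ := by push_cast; ring

variable [NormedAlgebra ℝ A]

/-- The semigroup `exp (t G)` generated by an element `G` of a Banach algebra. -/
noncomputable def expSemigroup (G : A) (t : ℝ) : A := NormedSpace.exp (t • G)

lemma expSemigroup_zero (G : A) : expSemigroup G 0 = 1 := by
  rw [expSemigroup, zero_smul, NormedSpace.exp_zero]

variable [CompleteSpace A]

lemma expSemigroup_add (G : A) (s t : ℝ) :
    expSemigroup G (s + t) = expSemigroup G s * expSemigroup G t := by
  let _ : NormedAlgebra ℚ A := NormedAlgebra.restrictScalars ℚ ℝ A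
  rw [expSemigroup, add_smul, NormedSpace.exp_add_of_commute
    (((Commute.refl G).smul_left s).smul_right t)]
  rfl

lemma expSemigroup_nat_mul (G : A) (n : ℕ) (s : ℝ) :
    expSemigroup G (n * s) = expSemigroup G s ^ n := by
  induction n with
  | zero => simp [expSemigroup_zero]
  | succ n ih => rw [pow_succ, ← ih, ← expSemigroup_add, Nat.cast_succ, add_one_mul]

lemma hasDerivAt_expSemigroup (G : A) (t : ℝ) :
    HasDerivAt (expSemigroup G) (expSemigroup G t * G) t :=
  hasDerivAt_exp_smul_const G t

lemma eventually_norm_expSemigroup_sub_le (G : A) {ε : ℝ} (hε : 0 < ε) :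
    ∀ᶠ s : ℝ in 𝓝 0, ‖expSemigroup G s - 1 - s • G‖ ≤ ε * |s| := by
  have h := hasDerivAt_iff_isLittleO.1 (hasDerivAt_expSemigroup G 0)
  filter_upwards [h.bound hε] with s hs
  simpa [expSemigroup_zero] using hs

/-- A family of contractions which agrees with `1 + h G` up to `O(h ^ 2)` generates the
exponential. -/
theorem tendsto_pow_exp_smul {G : A} {S : ℝ → A} {c : ℝ} (hS : ∀ h, 0 ≤ h → ‖S h‖ ≤ 1)
    (hSG : ∀ h, 0 ≤ h → ‖S h - 1 - h • G‖ ≤ c * h ^ 2) {t : ℝ} (ht : 0 ≤ t) :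
    Tendsto (fun n : ℕ => S (t / n) ^ n) atTop (𝓝 (expSemigroup G t)) := by
  have hcont : Continuous (expSemigroup G) :=
    continuous_iff_continuousAt.2 fun s => (hasDerivAt_expSemigroup G s).continuousAt
  obtain ⟨M, hM⟩ := (isCompact_Icc (a := (0 : ℝ)) (b := t)).exists_bound_of_continuousOn
    hcont.continuousOn
  have hM0 : 0 ≤ M := (norm_nonneg _).trans (hM 0 ⟨le_rfl, ht⟩)
  have hdiv : Tendsto (fun n : ℕ => t / n) atTop (𝓝 0) := tendsto_const_div_atTop_nhds_zero_nat t
  rw [tendsto_iff_norm_sub_tendsto_zero]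
  have hbound : ∀ ε > 0, ∀ᶠ n : ℕ in atTop,
      ‖S (t / n) ^ n - expSemigroup G t‖ ≤ t * (c * (t / n) + ε) * M := by
    intro ε hε
    filter_upwards [hdiv.eventually (eventually_norm_expSemigroup_sub_le G hε),
      eventually_gt_atTop 0] with n hn hn0
    have hn0' : (0 : ℝ) < n := by exact_mod_cast hn0
    have htn : 0 ≤ t / n := by positivity
    have hnt : n * (t / n) = t := by field_simp
    have hU : expSemigroup G t = expSemigroup G (t / n) ^ n := by
      rw [← expSemigroup_nat_mul, hnt]
    rw [abs_of_nonneg htn] at hn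
    rw [hU]
    calc _ ≤ n * (‖S (t / n) - expSemigroup G (t / n)‖ * M) := by
          refine norm_pow_sub_pow_le (hS _ htn) n fun k hk => ?_
          rw [← expSemigroup_nat_mul]
          refine hM _ ⟨by positivity, ?_⟩
          calc (k : ℝ) * (t / n) ≤ n * (t / n) := by gcongr
            _ = t := hnt
      _ ≤ n * ((c * (t / n) ^ 2 + ε * (t / n)) * M) := by
          gcongr
          have : S (t / n) - expSemigroup G (t / n) = (S (t / n) - 1 - (t / n) • G) -
              (expSemigroup G (t / n) - 1 - (t / n) • G) := by abel
          rw [this]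
          exact (norm_sub_le _ _).trans (add_le_add (hSG _ htn) hn)
      _ = (n * (t / n)) * (c * (t / n) + ε) * M := by ring
      _ = _ := by rw [hnt]
  refine (tendsto_order.2 ⟨fun b hb => Eventually.of_forall fun n => hb.trans_le (norm_nonneg _),
    fun δ hδ => ?_⟩)
  set ε := δ / (2 * (t * M + 1))
  have htM : 0 ≤ t * M := mul_nonneg ht hM0
  have hε : 0 < ε := by positivity
  have hlim : Tendsto (fun n : ℕ => t * (c * (t / n) + ε) * M) atTop (𝓝 (t * (c * 0 + ε) * M)) :=
    (((hdiv.const_mul c).add_const ε).const_mul t).mul_const M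
  have hlt : t * (c * 0 + ε) * M < δ := by
    have h1 : ε * (2 * (t * M + 1)) = δ := div_mul_cancel₀ _ (by positivity)
    nlinarith
  filter_upwards [hbound ε hε, hlim.eventually_lt_const hlt] with n h1 h2
  exact h1.trans_lt h2

end BanachAlgebra

/-! ### Bounded operators on bounded functions -/

section BoundedFunctions

variable {S : Type*} [TopologicalSpace S] [DiscreteTopology S]

/-- A linear operator on functions that is bounded for the supremum norm, as an element of the
Banach algebra of operators on bounded functions. -/
noncomputable def boundedOp (T : (S → ℝ) →ₗ[ℝ] S → ℝ) {K : ℝ} (hK : 0 ≤ K)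
    (hT : ∀ (f : S → ℝ) (C : ℝ), (∀ x, |f x| ≤ C) → ∀ x, |T f x| ≤ K * C) :
    BoundedContinuousFunction S ℝ →L[ℝ] BoundedContinuousFunction S ℝ :=
  LinearMap.mkContinuous
    { toFun := fun f => BoundedContinuousFunction.ofNormedAddCommGroupDiscrete (T f) (K * ‖f‖)
        fun x => hT f ‖f‖ f.norm_coe_le_norm x
      map_add' := fun f g => by
        ext x
        exact congrFun (T.map_add f g) x
      map_smul' := fun c f => by
        ext x
        exact congrFun (T.map_smul c f) x } K
    fun f => (BoundedContinuousFunction.norm_le (by positivity)).2 fun x =>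
      hT f ‖f‖ f.norm_coe_le_norm x

lemma norm_boundedOp_le (T : (S → ℝ) →ₗ[ℝ] S → ℝ) {K : ℝ} (hK : 0 ≤ K)
    (hT : ∀ (f : S → ℝ) (C : ℝ), (∀ x, |f x| ≤ C) → ∀ x, |T f x| ≤ K * C) :
    ‖boundedOp T hK hT‖ ≤ K :=
  LinearMap.mkContinuous_norm_le _ hK _

lemma boundedOp_pow_apply (T : (S → ℝ) →ₗ[ℝ] S → ℝ) {K : ℝ} (hK : 0 ≤ K)
    (hT : ∀ (f : S → ℝ) (C : ℝ), (∀ x, |f x| ≤ C) → ∀ x, |T f x| ≤ K * C) (n : ℕ)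
    (f : BoundedContinuousFunction S ℝ) : ⇑((boundedOp T hK hT ^ n) f) = T^[n] f := by
  induction n with
  | zero => rfl
  | succ n ih =>
    rw [pow_succ', Function.iterate_succ_apply', ← ih]
    rfl

end BoundedFunctions

variable {N : ℕ}

/-- The generator as a linear map. -/
def generatorₗ (N : ℕ) (p : ℕ → ℕ → ℝ) : ((Fin N → ℤ) → ℝ) →ₗ[ℝ] (Fin N → ℤ) → ℝ where
  toFun := generator N p
  map_add' f g := by
    funext x
    simp only [generator, Pi.add_apply, ← Finset.sum_add_distrib]
    exact Finset.sum_congr rfl fun _ _ => by ring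
  map_smul' c f := by
    funext x
    simp only [generator, Pi.smul_apply, smul_eq_mul, Finset.mul_sum, RingHom.id_apply]
    exact Finset.sum_congr rfl fun _ _ => by ring

/-- A bound for the norm of the generator on bounded functions. -/
def generatorBound (N : ℕ) (p : ℕ → ℕ → ℝ) : ℝ :=
  ∑ IJ : Finset (Fin N) × Finset (Fin N), |p IJ.1.card IJ.2.card| * 2

lemma generatorBound_nonneg (N : ℕ) (p : ℕ → ℕ → ℝ) : 0 ≤ generatorBound N p :=
  Finset.sum_nonneg fun _ _ => by positivity

lemma abs_generator_le (p : ℕ → ℕ → ℝ) (f : (Fin N → ℤ) → ℝ) (C : ℝ) (hf : ∀ x, |f x| ≤ C)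
    (x : Fin N → ℤ) : |generatorₗ N p f x| ≤ generatorBound N p * C := by
  have hC : 0 ≤ C := (abs_nonneg _).trans (hf x)
  calc |generator N p f x|
      ≤ ∑ IJ ∈ splittings x, |p IJ.1.card IJ.2.card| * 2 * C := by
        refine (Finset.abs_sum_le_sum_abs _ _).trans (Finset.sum_le_sum fun IJ _ => ?_)
        rw [abs_mul, mul_assoc]
        refine mul_le_mul_of_nonneg_left ((abs_sub _ _).trans ?_) (abs_nonneg _)
        linarith [hf (x + vec IJ.1 IJ.2), hf x]
    _ ≤ ∑ IJ : Finset (Fin N) × Finset (Fin N), |p IJ.1.card IJ.2.card| * 2 * C :=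
        Finset.sum_le_univ_sum_of_nonneg fun IJ => by positivity
    _ = _ := by rw [generatorBound, Finset.sum_mul]

/-- The generator as a bounded operator. -/
noncomputable def generatorOp (N : ℕ) (p : ℕ → ℕ → ℝ) :
    BoundedContinuousFunction (Fin N → ℤ) ℝ →L[ℝ] BoundedContinuousFunction (Fin N → ℤ) ℝ :=
  boundedOp (generatorₗ N p) (generatorBound_nonneg N p) (abs_generator_le p)

section MeanStep

variable {Ω : Type*} [MeasurableSpace Ω] {P : Measure Ω} [IsProbabilityMeasure P]
  {w : Ω → ℤ → SignType → ℝ}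

/-- The averaged step as a linear map. -/
noncomputable def meanStepₗ (N : ℕ) (hw : ∀ ω y, IsWeight (w ω y))
    (hwm : ∀ y, Measurable fun ω => w ω y) : ((Fin N → ℤ) → ℝ) →ₗ[ℝ] (Fin N → ℤ) → ℝ where
  toFun := meanStep P w
  map_add' f g := by
    funext x
    simp only [meanStep_eq_sum hw hwm, Pi.add_apply, ← Finset.sum_add_distrib, mul_add]
  map_smul' c f := by
    funext x
    simp only [meanStep_eq_sum hw hwm, Pi.smul_apply, smul_eq_mul, Finset.mul_sum,
      RingHom.id_apply]
    exact Finset.sum_congr rfl fun _ _ => by ring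

lemma abs_meanStep_le (hw : ∀ ω y, IsWeight (w ω y)) (hwm : ∀ y, Measurable fun ω => w ω y)
    (f : (Fin N → ℤ) → ℝ) (C : ℝ) (hf : ∀ x, |f x| ≤ C) (x : Fin N → ℤ) :
    |meanStepₗ (P := P) N hw hwm f x| ≤ 1 * C := by
  have := norm_integral_le_of_norm_le_const (μ := P) (C := C)
    (f := fun ω => stepOp (w ω) f x)
    (Eventually.of_forall fun ω => abs_stepOp_le (hw ω) hf x)
  simpa [meanStepₗ, meanStep] using this

end MeanStep

/-! ### The semigroup as an operator exponential -/

lemma integral_bind_eq {Ω S : Type*} [MeasurableSpace Ω] [MeasurableSpace S] {P : Measure Ω}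
    {m : Ω → Measure S} (hm : AEMeasurable m P) {f : S → ℝ} (hf : Integrable f (P.bind m)) :
    ∫ y, f y ∂(P.bind m) = ∫ ω, ∫ y, f y ∂(m ω) ∂P := by
  -- the Bochner integral of a composition is available for kernels only
  have hbind : P.bind m = P.bind (hm.mk m) := Measure.bind_congr_right hm.ae_eq_mk
  have hcomp : P.bind (hm.mk m) =
      ((⟨hm.mk m, hm.measurable_mk⟩ : Kernel Ω S) ∘ₖ Kernel.const Unit P) () := by
    rw [Kernel.comp_apply]
    rfl
  rw [hbind, hcomp] at hf
  rw [hbind, hcomp, Kernel.integral_comp hf]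
  refine integral_congr_ae ?_
  filter_upwards [hm.ae_eq_mk] with ω hω
  rw [hω]
  rfl

/-- A map into measures is almost everywhere measurable if the measure of each set is almost surely
the eventual value of a sequence of measurable functions. -/
lemma aemeasurable_of_eventually_eq {Ω S : Type*} [MeasurableSpace Ω] [MeasurableSpace S]
    {P : Measure Ω} {m : Ω → Measure S} {g : ℕ → Set S → Ω → ℝ≥0∞}
    (hg : ∀ k A, MeasurableSet A → Measurable (g k A))
    (h : ∀ᵐ ω ∂P, ∀ᶠ k in atTop, ∀ A, MeasurableSet A → m ω A = g k A ω) : AEMeasurable m P := by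
  classical
  obtain ⟨G, hG, hGm, hGg⟩ := h.exists_measurable_mem
  refine ⟨fun ω => if ω ∈ G then m ω else 0, ?_, ?_⟩
  · refine Measure.measurable_of_measurable_coe _ fun A hA => ?_
    refine measurable_of_tendsto_metrizable (f := fun k ω => if ω ∈ G then g k A ω else 0)
      (fun k => Measurable.ite hGm (hg k A hA) measurable_const) (tendsto_pi_nhds.2 fun ω => ?_)
    by_cases hω : ω ∈ G
    · simp only [hω, if_true]
      refine tendsto_const_nhds.congr' ?_
      filter_upwards [hGg ω hω] with k hk using hk A hA
    · simp [hω]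
  · filter_upwards [hG] with ω hω
    exact (if_pos hω).symm

lemma pathOp_one {N : ℕ} {z : ℕ → ℤ → SignType → ℝ} (hz : ∀ j y, IsWeight (z j y)) (n : ℕ)
    (x : Fin N → ℤ) : pathOp z n (fun _ => 1) x = 1 := by
  induction n generalizing z x with
  | zero => rfl
  | succ n ih =>
    simp only [pathOp, stepOp, ih fun j => hz (j + 1), mul_one]
    exact sum_prod_eq_one fun i => hz 0 (x i)

namespace IsPoissonEnvironment

variable {Ω : Type*} [MeasurableSpace Ω] {P : Measure Ω} {μ : Measure unitInterval}
  {env : Ω → Config}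

lemma measurable_cellWeight (henv : IsPoissonEnvironment P μ env) (h s : ℝ) (j : ℕ) (y : ℤ) :
    Measurable fun ω => (env ω).cellWeight h s j y :=
  henv.measurable_cell_weight (measurableSet_cell _ _ _)

lemma nPointSemigroup_apply (env : Ω → Config) {N : ℕ} (t : ℝ≥0) (x : Fin N → ℤ) :
    nPointSemigroup P env N t x = P.bind fun ω => Measure.pi fun i => (env ω).K 0 t (x i) := rfl

variable [IsProbabilityMeasure P]

/-- The joint quenched law of the particles is almost everywhere measurable in the environment. -/
lemma aemeasurable_pi_K (henv : IsPoissonEnvironment P μ env) {N : ℕ} {t : ℝ} (ht : 0 ≤ t)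
    (x : Fin N → ℤ) : AEMeasurable (fun ω => Measure.pi fun i => (env ω).K 0 t (x i)) P := by
  classical
  refine aemeasurable_of_eventually_eq (g := fun k A ω => ENNReal.ofReal
    (pathOp ((env ω).cellWeight (t / 2 ^ k) 0) (2 ^ k) (A.indicator fun _ => 1) x))
    (fun k A _ => (measurable_pathOp (henv.measurable_cellWeight _ 0) _ _ _).ennreal_ofReal) ?_
  filter_upwards [henv.ae_eventually_integral_pi_K ht x] with ω hω
  filter_upwards [hω] with k hk A hA
  rw [← hk (A.indicator fun _ => 1) 1 fun y => by
    by_cases hy : y ∈ A <;> simp [hy], integral_indicator_const _ hA, smul_eq_mul, mul_one,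
    ofReal_measureReal]

lemma ae_isProbabilityMeasure_pi_K (henv : IsPoissonEnvironment P μ env) {N : ℕ} {t : ℝ}
    (ht : 0 ≤ t) (x : Fin N → ℤ) :
    ∀ᵐ ω ∂P, IsProbabilityMeasure (Measure.pi fun i => (env ω).K 0 t (x i)) := by
  filter_upwards [henv.ae_eventually_integral_pi_K ht x] with ω hω
  obtain ⟨k, hk⟩ := hω.exists
  have := hk (fun _ => 1) 1 (fun _ => by simp)
  rw [pathOp_one fun j y => (env ω).isWeight_cellWeight _ 0 j y, integral_const, smul_eq_mul,
    mul_one] at this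
  exact ⟨(ENNReal.toReal_eq_one_iff _).1 this⟩

lemma isMarkovKernel_nPointSemigroup (henv : IsPoissonEnvironment P μ env) (N : ℕ) (t : ℝ≥0) :
    IsMarkovKernel (nPointSemigroup P env N t) := by
  refine ⟨fun x => ⟨?_⟩⟩
  rw [nPointSemigroup_apply, Measure.bind_apply .univ (henv.aemeasurable_pi_K t.coe_nonneg x)]
  have : ∀ᵐ ω ∂P, Measure.pi (fun i => (env ω).K 0 t (x i)) Set.univ = 1 := by
    filter_upwards [henv.ae_isProbabilityMeasure_pi_K t.coe_nonneg x] with ω hω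
    exact hω.measure_univ
  rw [lintegral_congr_ae this]
  simp

lemma integrable_nPointSemigroup (henv : IsPoissonEnvironment P μ env) {N : ℕ} (t : ℝ≥0)
    (f : BoundedContinuousFunction (Fin N → ℤ) ℝ) (x : Fin N → ℤ) :
    Integrable f (nPointSemigroup P env N t x) := by
  have := henv.isMarkovKernel_nPointSemigroup N t
  exact Integrable.of_bound Measurable.of_discrete.aestronglyMeasurable ‖f‖
    (Eventually.of_forall f.norm_coe_le_norm)

lemma iIndepFun_cellWeight (henv : IsPoissonEnvironment P μ env) {h : ℝ} (hh : 0 ≤ h) (s : ℝ) :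
    iIndepFun (fun (c : ℕ × ℤ) ω => (env ω).cellWeight h s c.1 c.2) P := by
  refine henv.iIndepFun_weight (B := fun c : ℕ × ℤ =>
    Set.Ioc (s + c.1 * h) (s + (c.1 + 1) * h) ×ˢ {c.2}) (fun c => measurableSet_cell _ _ _) ?_
  rintro ⟨j, y⟩ ⟨j', y'⟩ hne
  have hmono : Monotone fun j : ℕ => s + j * h := fun j j' hj => by
    have : (j : ℝ) ≤ j' := by exact_mod_cast hj
    simp only
    gcongr
  have hdisj := hmono.pairwise_disjoint_on_Ioc_succ
  by_cases hy : y = y'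
  · have hj : j ≠ j' := fun hj => hne (Prod.ext hj hy)
    have := hdisj hj
    simp only [Function.onFun, Nat.succ_eq_succ, Nat.succ_eq_add_one, Nat.cast_add,
      Nat.cast_one] at this
    exact Set.disjoint_prod.2 (Or.inl this)
  · exact Set.disjoint_prod.2 (Or.inr (Set.disjoint_singleton.2 hy))

variable [IsProbabilityMeasure μ]

lemma map_cellWeight (henv : IsPoissonEnvironment P μ env) {h : ℝ} (hh : 0 ≤ h) (s : ℝ) (j : ℕ)
    (y : ℤ) : P.map (fun ω => (env ω).cellWeight h s j y) =
      ENNReal.ofReal (1 - h * Real.exp (-h)) • Measure.dirac stay +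
        ENNReal.ofReal (h * Real.exp (-h)) • μ.map jump := by
  refine henv.map_weight (measurableSet_cell _ _ _) hh ?_
  rw [intensity_cell, Set.encard_singleton]
  simp only [ENat.toENNReal_one, mul_one]
  congr 1
  ring

/-- The averaged step of mesh `h`, as a bounded operator. -/
noncomputable def meanOp (henv : IsPoissonEnvironment P μ env) (N : ℕ) (h : ℝ) :
    BoundedContinuousFunction (Fin N → ℤ) ℝ →L[ℝ] BoundedContinuousFunction (Fin N → ℤ) ℝ :=
  boundedOp (meanStepₗ (P := P) N (w := fun ω => (env ω).cellWeight h 0 0)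
    (fun ω => (env ω).isWeight_cellWeight h 0 0) (henv.measurable_cellWeight h 0 0)) zero_le_one
    (abs_meanStep_le _ _)

/-- The averaged step of mesh `h` is `1 + h 𝒢 + O(h ^ 2)`. -/
lemma norm_meanOp_sub_le (henv : IsPoissonEnvironment P μ env) (N : ℕ) {h : ℝ} (hh : 0 ≤ h) :
    ‖henv.meanOp N h - 1 - h • generatorOp N (splitRate μ)‖ ≤
      (2 * (N + 1) * N ^ 2 + generatorBound N (splitRate μ)) * h ^ 2 := by
  have hK := generatorBound_nonneg N (splitRate μ)
  refine ContinuousLinearMap.opNorm_le_bound _ (by positivity) fun f => ?_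
  refine (BoundedContinuousFunction.norm_le (by positivity)).2 fun x => ?_
  set a := h * Real.exp (-h)
  have ha : 0 ≤ a := by positivity
  have hexp : Real.exp (-h) ≤ 1 := Real.exp_le_one_iff.2 (by linarith)
  have hah : a ≤ h := mul_le_of_le_one_right hh hexp
  have hah2 : h - a ≤ h ^ 2 := by
    have := Real.add_one_le_exp (-h)
    simp only [a]
    nlinarith
  have hf : ∀ y, |f y| ≤ ‖f‖ := f.norm_coe_le_norm
  have hmain := abs_meanStep_sub_le (fun ω => (env ω).isWeight_cellWeight h 0 0)
    (henv.measurable_cellWeight h 0 0)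
    ((henv.iIndepFun_cellWeight hh 0).precomp (g := fun y => (0, y))
      fun y y' hy => (Prod.ext_iff.1 hy).2) ha (henv.map_cellWeight hh 0 0) hf x
  have hgen := abs_generator_le (splitRate μ) f ‖f‖ hf x
  set g := generator N (splitRate μ) f x
  have hgen' : |g| ≤ generatorBound N (splitRate μ) * ‖f‖ := hgen
  set q := meanStep P (fun ω => (env ω).cellWeight h 0 0) f x
  change |q - f x - h * g| ≤ _
  calc |q - f x - h * g| = |(q - f x - a * g) + -((h - a) * g)| := by congr 1; ring
    _ ≤ |q - f x - a * g| + (h - a) * |g| := by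
        refine (abs_add_le _ _).trans_eq ?_
        rw [abs_neg, abs_mul, abs_of_nonneg (sub_nonneg.2 hah)]
    _ ≤ 2 * (N + 1) * N ^ 2 * ‖f‖ * h ^ 2 +
          h ^ 2 * (generatorBound N (splitRate μ) * ‖f‖) := by
        gcongr
        exact hmain.trans (by gcongr)
    _ = _ := by ring

/-- The averaged discretized flow converges to the exponential of the generator. -/
lemma tendsto_integral_pathOp (henv : IsPoissonEnvironment P μ env) {N : ℕ} {t : ℝ} (ht : 0 ≤ t)
    (f : BoundedContinuousFunction (Fin N → ℤ) ℝ) (x : Fin N → ℤ) :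
    Tendsto (fun k : ℕ => ∫ ω, pathOp ((env ω).cellWeight (t / 2 ^ k) 0) (2 ^ k) f x ∂P) atTop
      (𝓝 (expSemigroup (generatorOp N (splitRate μ)) t f x)) := by
  have hlim := (tendsto_pow_exp_smul (G := generatorOp N (splitRate μ)) (S := henv.meanOp N)
    (fun h _ => norm_boundedOp_le _ _ _) (fun h hh => henv.norm_meanOp_sub_le N hh) ht).comp
    (tendsto_pow_atTop_atTop_of_one_lt (one_lt_two : 1 < 2))
  have heval : Continuous fun T : BoundedContinuousFunction (Fin N → ℤ) ℝ →L[ℝ]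
      BoundedContinuousFunction (Fin N → ℤ) ℝ => T f x :=
    (BoundedContinuousFunction.evalCLM ℝ x).continuous.comp
      (ContinuousLinearMap.apply ℝ _ f).continuous
  refine ((heval.tendsto _).comp hlim).congr fun k => ?_
  have hh : 0 ≤ t / 2 ^ k := by positivity
  have hpath := integral_pathOp (P := P) (z := fun ω => (env ω).cellWeight (t / 2 ^ k) 0)
    (fun ω => (env ω).isWeight_cellWeight _ 0) (henv.measurable_cellWeight _ 0)
    (henv.iIndepFun_cellWeight hh 0)
    (fun j y => (henv.map_cellWeight hh 0 j y).trans (henv.map_cellWeight hh 0 0 y).symm)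
    (f := f) f.norm_coe_le_norm (2 ^ k) 0 x
  simp only [zero_add] at hpath
  rw [hpath]
  simp only [Function.comp_apply, Nat.cast_pow, Nat.cast_ofNat]
  rw [meanOp, boundedOp_pow_apply]
  rfl

/-- The transition operators of the `N`-point motion are the exponentials of the generator. -/
theorem integral_nPointSemigroup (henv : IsPoissonEnvironment P μ env) {N : ℕ} (t : ℝ≥0)
    (f : BoundedContinuousFunction (Fin N → ℤ) ℝ) (x : Fin N → ℤ) :
    ∫ y, f y ∂(nPointSemigroup P env N t x) =
      expSemigroup (generatorOp N (splitRate μ)) t f x := by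
  rw [nPointSemigroup_apply, integral_bind_eq (henv.aemeasurable_pi_K t.coe_nonneg x)
    (henv.integrable_nPointSemigroup t f x)]
  refine tendsto_nhds_unique ?_ (henv.tendsto_integral_pathOp t.coe_nonneg f x)
  refine tendsto_integral_of_dominated_convergence (fun _ => ‖f‖)
    (fun k => (measurable_pathOp (henv.measurable_cellWeight _ 0) _ _ _).aestronglyMeasurable)
    (integrable_const _) (fun k => Eventually.of_forall fun ω =>
      abs_pathOp_le ((env ω).isWeight_cellWeight _ 0) _ f.norm_coe_le_norm x) ?_
  filter_upwards [henv.ae_eventually_integral_pi_K t.coe_nonneg x] with ω hω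
  refine tendsto_const_nhds.congr' ?_
  filter_upwards [hω] with k hk using hk f ‖f‖ f.norm_coe_le_norm

/-- Transition probabilities in terms of the exponentials of the generator. -/
lemma nPointSemigroup_apply_eq_ofReal (henv : IsPoissonEnvironment P μ env) {N : ℕ} (t : ℝ≥0)
    (x : Fin N → ℤ) {A : Set (Fin N → ℤ)} {f : BoundedContinuousFunction (Fin N → ℤ) ℝ}
    (hf : ⇑f = A.indicator fun _ => 1) : nPointSemigroup P env N t x A =
      ENNReal.ofReal (expSemigroup (generatorOp N (splitRate μ)) t f x) := by
  have := henv.isMarkovKernel_nPointSemigroup N t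
  rw [← henv.integral_nPointSemigroup, hf, integral_indicator_const _ .of_discrete, smul_eq_mul,
    mul_one, ofReal_measureReal]

lemma exists_indicator (A : Set (Fin N → ℤ)) :
    ∃ f : BoundedContinuousFunction (Fin N → ℤ) ℝ, ⇑f = A.indicator fun _ => 1 := by
  classical
  exact ⟨BoundedContinuousFunction.ofNormedAddCommGroupDiscrete (A.indicator fun _ => 1) 1
    fun y => by by_cases hy : y ∈ A <;> simp [hy], rfl⟩

theorem isMarkovSemigroup (henv : IsPoissonEnvironment P μ env) (N : ℕ) :
    IsMarkovSemigroup (nPointSemigroup P env N) := by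
  refine ⟨henv.isMarkovKernel_nPointSemigroup N, ?_, fun s t => ?_⟩
  · refine Kernel.ext fun x => Measure.ext fun A hA => ?_
    obtain ⟨f, hf⟩ := exists_indicator A
    rw [henv.nPointSemigroup_apply_eq_ofReal 0 x hf, Kernel.id_apply, Measure.dirac_apply' _ hA]
    rw [NNReal.coe_zero, expSemigroup_zero, one_apply_eq_self, hf]
    by_cases hx : x ∈ A <;> simp [hx]
  · refine Kernel.ext fun x => Measure.ext fun A hA => ?_
    obtain ⟨f, hf⟩ := exists_indicator A
    set G := generatorOp N (splitRate μ)
    have := henv.isMarkovKernel_nPointSemigroup N t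
    have hpos : ∀ y, 0 ≤ expSemigroup G t f y := fun y => by
      rw [← henv.integral_nPointSemigroup, hf]
      exact integral_nonneg fun z => Set.indicator_nonneg (fun _ _ => zero_le_one) z
    have hadd : expSemigroup G (s + t : ℝ≥0) f = expSemigroup G s (expSemigroup G t f) := by
      rw [NNReal.coe_add, expSemigroup_add]
      rfl
    rw [Kernel.comp_apply' _ _ _ hA, henv.nPointSemigroup_apply_eq_ofReal _ x hf, hadd,
      ← henv.integral_nPointSemigroup, ofReal_integral_eq_lintegral_ofReal
      (henv.integrable_nPointSemigroup s _ x) (Eventually.of_forall hpos)]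
    exact lintegral_congr fun y => (henv.nPointSemigroup_apply_eq_ofReal t y hf).symm

theorem isMarkovChainWithGenerator (henv : IsPoissonEnvironment P μ env) (N : ℕ) :
    IsMarkovChainWithGenerator (nPointSemigroup P env N) (generator N (splitRate μ)) := by
  refine ⟨henv.isMarkovSemigroup N, ?_⟩
  rintro f ⟨C, hC⟩
  obtain ⟨F, hF⟩ : ∃ F : BoundedContinuousFunction (Fin N → ℤ) ℝ, ⇑F = f :=
    ⟨BoundedContinuousFunction.ofNormedAddCommGroupDiscrete f C hC, rfl⟩
  set G := generatorOp N (splitRate μ)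
  rw [Metric.tendstoUniformly_iff]
  intro ε hε
  have hcoe : Tendsto (fun t : ℝ≥0 => (t : ℝ)) (𝓝[>] 0) (𝓝 0) :=
    (NNReal.continuous_coe.tendsto 0).mono_left nhdsWithin_le_nhds
  have hδ : 0 < ε / (‖F‖ + 1) := by positivity
  filter_upwards [hcoe.eventually (eventually_norm_expSemigroup_sub_le G hδ), self_mem_nhdsWithin]
    with t ht ht0 x
  have ht0' : (0 : ℝ) < t := ht0
  rw [abs_of_pos ht0'] at ht
  set T := expSemigroup G t
  have hgen : generator N (splitRate μ) f x = G F x := by rw [← hF]; rfl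
  have hint : ∫ y, f y ∂(nPointSemigroup P env N t x) = T F x := by
    rw [← henv.integral_nPointSemigroup, hF]
  rw [hint, hgen, ← hF, dist_comm, Real.dist_eq]
  have hnorm : |T F x - F x - t * G F x| ≤ ε / (‖F‖ + 1) * t * ‖F‖ :=
    (((T - 1 - (t : ℝ) • G) F).norm_coe_le_norm x).trans
      ((ContinuousLinearMap.le_opNorm _ F).trans (by gcongr))
  have heq : (T F x - F x) / t - G F x = (T F x - F x - t * G F x) / t := by field_simp
  rw [heq, abs_div, abs_of_pos ht0', div_lt_iff₀ ht0']
  refine hnorm.trans_lt ?_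
  have : ε / (‖F‖ + 1) * (‖F‖ + 1) = ε := div_mul_cancel₀ _ (by positivity)
  nlinarith [mul_pos hδ ht0']

end IsPoissonEnvironment

lemma isConsistentFamily_splitRate (μ : Measure unitInterval) [IsProbabilityMeasure μ] :
    IsConsistentFamily (splitRate μ) := by
  have hint : ∀ k l : ℕ, Integrable
      (fun r : unitInterval => (r : ℝ) ^ k * (1 - (r : ℝ)) ^ l) μ := fun k l =>
    (by fun_prop : Continuous _).integrable_of_hasCompactSupport
      (HasCompactSupport.of_compactSpace _)
  refine ⟨fun k l => integral_nonneg fun r => mul_nonneg (pow_nonneg r.2.1 _)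
    (pow_nonneg (sub_nonneg.2 r.2.2) _), fun k l => ?_⟩
  rw [splitRate, splitRate, splitRate, ← integral_add (hint _ _) (hint _ _)]
  exact integral_congr_ae (Eventually.of_forall fun r => by simp only; ring)

end LatticeFlow

theorem proposition8p2 {Ω : Type*} [MeasurableSpace Ω] (P : Measure Ω) [IsProbabilityMeasure P]
    (μ : Measure unitInterval) [IsProbabilityMeasure μ]
    (env : Ω → LatticeFlow.Config) (henv : LatticeFlow.IsPoissonEnvironment P μ env) (N : ℕ) :
    (∀ (t : ℝ≥0) (x : Fin N → ℤ) (A : Fin N → Set ℤ),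
      LatticeFlow.nPointSemigroup P env N t x (Set.univ.pi A) =
        ∫⁻ ω, ∏ i, (env ω).K 0 t (x i) (A i) ∂P) ∧
    LatticeFlow.IsConsistentFamily (LatticeFlow.splitRate μ) ∧
    LatticeFlow.IsMarkovChainWithGenerator (LatticeFlow.nPointSemigroup P env N)
      (LatticeFlow.generator N (LatticeFlow.splitRate μ)) := by
  refine ⟨fun t x A => ?_, LatticeFlow.isConsistentFamily_splitRate μ,
    henv.isMarkovChainWithGenerator N⟩
  rw [LatticeFlow.IsPoissonEnvironment.nPointSemigroup_apply,
    Measure.bind_apply .of_discrete (henv.aemeasurable_pi_K t.coe_nonneg x)]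
  exact lintegral_congr fun ω => Measure.pi_pi _ _
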